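/- Fix a field $k$ and an integer $d\ge 0$. A ($d$-parameter persistence) module is a functor $M$ from the poset $\mathbb R^d$ (product order) to $k$-vector spaces, and morphisms are natural transformations. $M$ is pfd if every $M_p$ is finite-dimensional, and $\operatorname{supdim} M=\sup_p\dim M_p$. For $\varepsilon\in\mathbb R$ the shift $M(\varepsilon)$ is given by $M(\varepsilon)_p=M_{p+(\varepsilon,\dots,\varepsilon)}$, and for $\varepsilon\ge 0$ the structure maps define $M_{0\to\varepsilon}\colon M\to M(\varepsilon)$. For an upward closed set $U\subseteq\mathbb R^d$, the upset module of $U$ is $k$ on $U$ and $0$ elsewhere, with identity structure maps inside $U$; a module is upset-decomposable if it is isomorphic to a direct sum of upset modules. *Bottleneck distance.* $M$ and $N$ are $\varepsilon$-interleaved ($M\sim_\varepsilon N$) if there are morphisms $\varphi\colon M\to N(\varepsilon)$, $\psi\colon N\to M(\varepsilon)$ with $\psi(\varepsilon)\circ\varphi=M_{0\to2\varepsilon}$ and $\varphi(\varepsilon)\circ\psi=N_{0\to2\varepsilon}$. The barcode of a pfd module is the multiset of the isomorphism classes of the summands in its decomposition into nonzero indecomposables. An $\varepsilon$-matching between $M$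 and $N$ is a bijection between a part of the barcode of $M$ and a part of the barcode of $N$ such that matched modules are $\varepsilon$-interleaved and every unmatched module is $\varepsilon$-interleaved with $0$. Let $d_B(M,N)\in[0,\infty]$ be the infimum of the $\varepsilon\ge0$ for which an $\varepsilon$-matching exists. *Pruning distance.* Let $I$ be the largest submodule of $M$ with $f(I)\subseteq M_{0\to2\varepsilon}(I)$ for every morphism $f\colon M\to M(2\varepsilon)$, let $K$ be the smallest submodule of $I$ with $I_{0\to2\varepsilon}^{-1}(f(K))\subseteq K$ for every such $f$, and put $\operatorname{Pru}_\varepsilon(M)=(I/K)(-\varepsilon)$. A subquotient of a module is a module isomorphic to $I'/K'$ for submodules $K'\subseteq I'$ of it. An $\infty$-refinement of $M\cong\bigoplus_{i}M_i$ (all $M_i$ indecomposable) is a module isomorphic to some $\bigoplus_i N_i$ with $N_i$ a subquotient of $M_i$ for each $i$. Let $d_P(M,N)\in[0,\infty]$ be the infimum of the $\varepsilon\ge0$ such that for all $\delta\ge0$ the module $\operatorname{Pru}_{\varepsilon+\delta}(M)$ is an $\infty$-refinement of $\operatorname{Pru}_\delta(N)$ and $\operatorname{Pru}_{\varepsilon+\delta}(N)$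 is an $\infty$-refinement of $\operatorname{Pru}_\delta(M)$. **Theorem.** Let $M$ and $N$ be pfd upset-decomposable modules. Then $$d_P(M,N)\le d_B(M,N).$$ Moreover $d_P$ and $d_B$ are Lipschitz equivalent on upset-decomposable modules of bounded pointwise dimension: if $r\ge1$ is an integer with $\operatorname{supdim}M\le r$ and $\operatorname{supdim}N\le r$, then $$d_P(M,N)\le d_B(M,N)\le(2r-1)\,d_P(M,N).$$ -/

import Mathlib

open CategoryTheory
open scoped NNReal ENNReal DirectSum

universe u

noncomputable section

namespace Persistence

/-- The poset `ℝ^d` with the product order (a type of its own, so that as a category it is the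
poset category). -/
def Pt (d : ℕ) : Type := Fin d → ℝ

instance (d : ℕ) : PartialOrder (Pt d) := inferInstanceAs (PartialOrder (Fin d → ℝ))

/-- `d`-parameter persistence modules over the field `k`: functors from the poset `ℝ^d` to
`k`-vector spaces; morphisms are natural transformations. -/
abbrev PersMod (k : Type u) [Field k] (d : ℕ) : Type (u + 1) := Pt d ⥤ ModuleCat.{u} k

variable {k : Type u} [Field k] {d : ℕ}

/-! ### Shifts and interleavings -/

/-- The shift `p ↦ p + (ε, …, ε)` of `ℝ^d`. -/
def shiftPt (ε : ℝ) (p : Pt d) : Pt d := fun i => p i + ε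

theorem shiftPt_mono (ε : ℝ) : Monotone (shiftPt ε : Pt d → Pt d) :=
  fun _ _ h i => add_le_add_left (h i) ε

theorem le_shiftPt {ε : ℝ} (hε : 0 ≤ ε) (p : Pt d) : p ≤ shiftPt ε p :=
  fun i => le_add_of_nonneg_right (a := p i) hε

/-- The shift `M(ε)`, with `M(ε)_p = M_{p + ε}`. -/
def shift (ε : ℝ) (M : PersMod k d) : PersMod k d := (shiftPt_mono ε).functor ⋙ M

/-- The morphism `M_{0 → ε} : M → M(ε)` for `ε ≥ 0`, given by the structure maps of `M`. -/
def toShift (ε : ℝ≥0) (M : PersMod k d) : M ⟶ shift (ε : ℝ) M where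
  app p := M.map (homOfLE (le_shiftPt ε.2 p))
  naturality p q h := by
    simp only [shift, Functor.comp_map, ← M.map_comp]
    rfl

/-- `M` and `N` are `ε`-interleaved: there are `φ : M → N(ε)` and `ψ : N → M(ε)` such that
`ψ(ε) ∘ φ` and `φ(ε) ∘ ψ` are the structure morphisms of `M` and `N` from parameter
`p` to `p + ε + ε`. -/
def Interleaved (ε : ℝ≥0) (M N : PersMod k d) : Prop :=
  ∃ (φ : M ⟶ shift (ε : ℝ) N) (ψ : N ⟶ shift (ε : ℝ) M),
    (∀ p : Pt d, φ.app p ≫ ψ.app (shiftPt ε p) =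
      M.map (homOfLE ((le_shiftPt ε.2 p).trans (le_shiftPt ε.2 (shiftPt ε p))))) ∧
    (∀ p : Pt d, ψ.app p ≫ φ.app (shiftPt ε p) =
      N.map (homOfLE ((le_shiftPt ε.2 p).trans (le_shiftPt ε.2 (shiftPt ε p)))))

/-! ### Direct sums, upset modules, dimension -/

/-- The pointwise direct sum of a family of persistence modules. -/
def dirSum {ι : Type u} (Q : ι → PersMod k d) : PersMod k d where
  obj p := ModuleCat.of k (⨁ i, (Q i).obj p)
  map h := ModuleCat.ofHom (DirectSum.lmap fun i => ((Q i).map h).hom)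
  map_id p := by
    ext1
    refine LinearMap.ext fun x => DFinsupp.ext fun i => ?_
    simp
  map_comp f g := by
    ext1
    refine LinearMap.ext fun x => DFinsupp.ext fun i => ?_
    simp [DirectSum.lmap_apply]

/-- The zero persistence module. -/
def zeroMod : PersMod k d := (Functor.const (Pt d)).obj (ModuleCat.of k PUnit)

/-- The value of the upset module of `U` at `p`, as a subspace of `k`:
all of `k` if `p ∈ U`, and `0` otherwise. -/
def upsetFiber (k : Type u) [Field k] (U : UpperSet (Pt d)) (p : Pt d) : Submodule k k where
  carrier := {x | p ∉ U → x = 0}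
  add_mem' hx hy h := by simp [hx h, hy h]
  zero_mem' _ := rfl
  smul_mem' c x hx h := by simp [hx h]

theorem upsetFiber_mono (U : UpperSet (Pt d)) {p q : Pt d} (h : p ≤ q) :
    upsetFiber k U p ≤ upsetFiber k U q :=
  fun _ hx hq => hx fun hp => hq (U.upper h hp)

/-- The upset module of `U`: `k` on `U`, `0` off `U`, with identity structure maps inside `U`. -/
def upsetMod (k : Type u) [Field k] (U : UpperSet (Pt d)) : PersMod k d where
  obj p := ModuleCat.of k (upsetFiber k U p)
  map h := ModuleCat.ofHom (Submodule.inclusion (upsetFiber_mono U (leOfHom h)))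
  map_id _ := rfl
  map_comp _ _ := rfl

/-- `M` is isomorphic to a direct sum of upset modules. -/
def UpsetDecomposable (M : PersMod k d) : Prop :=
  ∃ (ι : Type u) (U : ι → UpperSet (Pt d)), Nonempty (M ≅ dirSum fun i => upsetMod k (U i))

/-- Pointwise finite-dimensional modules. -/
def PFD (M : PersMod k d) : Prop := ∀ p : Pt d, Module.Finite k (M.obj p)

/-- The supremum of the pointwise dimensions of `M`. -/
def supdim (M : PersMod k d) : ℕ∞ := ⨆ p : Pt d, Cardinal.toENat (Module.rank k (M.obj p))

/-! ### Bottleneck distance -/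

/-- `M` is isomorphic to the direct sum of the (nonzero) indecomposable modules `Q i`; for a
pfd module such a family exists and is unique up to reindexing and isomorphism, and it is the
barcode of `M`. -/
def IsBarcode {ι : Type u} (Q : ι → PersMod k d) (M : PersMod k d) : Prop :=
  (∀ i, Indecomposable (Q i)) ∧ Nonempty (M ≅ dirSum Q)

/-- There is an `ε`-matching between `M` and `N`: a bijection `σ` between parts `S` and `T` of
their barcodes that matches `ε`-interleaved modules, all unmatched modules being
`ε`-interleaved with `0`. -/
def Matched (ε : ℝ≥0) (M N : PersMod k d) : Prop :=
  ∃ (ι κ : Type u) (Q : ι → PersMod k d) (R : κ → PersMod k d),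
    IsBarcode Q M ∧ IsBarcode R N ∧
    ∃ (S : Set ι) (T : Set κ) (σ : S ≃ T),
      (∀ s : S, Interleaved ε (Q s) (R (σ s))) ∧
      (∀ i ∉ S, Interleaved ε (Q i) zeroMod) ∧
      (∀ j ∉ T, Interleaved ε (R j) zeroMod)

/-- The bottleneck distance, with value `∞` if there is no matching. -/
def bottleneckDist (M N : PersMod k d) : ℝ≥0∞ :=
  ⨅ (ε : ℝ≥0) (_ : Matched ε M N), (ε : ℝ≥0∞)

/-! ### Submodules and prunings -/

/-- Submodules of a persistence module: pointwise subspaces stable under the structure maps. -/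
@[ext]
structure Sub (M : PersMod k d) where
  fiber : ∀ p : Pt d, Submodule k (M.obj p)
  map_le : ∀ {p q : Pt d} (h : p ⟶ q), (fiber p).map (M.map h).hom ≤ fiber q

variable {M : PersMod k d}

instance : PartialOrder (Sub M) :=
  PartialOrder.lift Sub.fiber fun _ _ h => Sub.ext h

/-- The sum of a set of submodules. -/
instance : SupSet (Sub M) where
  sSup 𝒮 :=
    { fiber := fun p => ⨆ I ∈ 𝒮, I.fiber p
      map_le := fun h => by
        simp only [Submodule.map_iSup]
        exact iSup₂_mono fun I _ => I.map_le h }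

/-- The intersection of a set of submodules. -/
instance : InfSet (Sub M) where
  sInf 𝒮 :=
    { fiber := fun p => ⨅ I ∈ 𝒮, I.fiber p
      map_le := fun h => le_iInf₂ fun I hI =>
        (Submodule.map_mono (iInf₂_le I hI)).trans (I.map_le h) }

/-- The condition on `I ⊆ M` that `f(I) ⊆ M_{0 → 2ε}(I)` for every `f : M → M(2ε)`. -/
def IsPruningUpper (ε : ℝ≥0) (I : Sub M) : Prop :=
  ∀ (f : M ⟶ shift ((2 * ε : ℝ≥0) : ℝ) M) (p : Pt d),
    (I.fiber p).map (f.app p).hom ≤ (I.fiber p).map ((toShift (2 * ε) M).app p).hom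

/-- The first member `I` of the `ε`-pruning pair: the largest submodule of `M` such that
`f(I) ⊆ M_{0 → 2ε}(I)` for every `f : M → M(2ε)`. -/
def pruningUpper (ε : ℝ≥0) (M : PersMod k d) : Sub M := sSup {I | IsPruningUpper ε I}

theorem pruningUpper_isGreatest (ε : ℝ≥0) (M : PersMod k d) :
    IsGreatest {I : Sub M | IsPruningUpper ε I} (pruningUpper ε M) := by
  constructor
  · intro f p
    simp only [pruningUpper, sSup, Submodule.map_iSup]
    exact iSup₂_mono fun I hI => hI f p
  · intro I hI p
    exact le_iSup₂ (f := fun (J : Sub M) (_ : J ∈ {I : Sub M | IsPruningUpper ε I}) => J.fiber p)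
      I hI

/-- The condition on `K ⊆ I` that `(I_{0 → 2ε})⁻¹(f(K)) ⊆ K` for every `f : M → M(2ε)`. -/
def IsPruningLower (ε : ℝ≥0) (I K : Sub M) : Prop :=
  K ≤ I ∧ ∀ (f : M ⟶ shift ((2 * ε : ℝ≥0) : ℝ) M) (p : Pt d),
    I.fiber p ⊓ ((K.fiber p).map (f.app p).hom).comap ((toShift (2 * ε) M).app p).hom
      ≤ K.fiber p

/-- The second member `K` of the `ε`-pruning pair: the smallest submodule of `I` such that
`(I_{0 → 2ε})⁻¹(f(K)) ⊆ K` for every `f : M → M(2ε)`. -/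
def pruningLower (ε : ℝ≥0) (M : PersMod k d) : Sub M :=
  sInf {K | IsPruningLower ε (pruningUpper ε M) K}

theorem pruningLower_isLeast (ε : ℝ≥0) (M : PersMod k d) :
    IsLeast {K : Sub M | IsPruningLower ε (pruningUpper ε M) K} (pruningLower ε M) := by
  have hle : ∀ K : Sub M, IsPruningLower ε (pruningUpper ε M) K → ∀ p,
      (pruningLower ε M).fiber p ≤ K.fiber p := fun K hK p =>
    iInf₂_le (f := fun (J : Sub M)
      (_ : J ∈ {K : Sub M | IsPruningLower ε (pruningUpper ε M) K}) => J.fiber p) K hK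
  refine ⟨⟨?_, fun f p => ?_⟩, fun K hK => hle K hK⟩
  · exact hle _ ⟨le_refl _, fun _ _ => inf_le_left⟩
  · refine le_iInf₂ fun K hK => le_trans ?_ (hK.2 f p)
    exact inf_le_inf_left _ (Submodule.comap_mono (Submodule.map_mono (hle K hK p)))

/-- The persistence module `I / K` for submodules `K ⊆ I` of `M`; its value at `p` is the
quotient of `I_p` by the subspace of its elements that lie in `K_p`. -/
def subquot (I K : Sub M) : PersMod k d where
  obj p := ModuleCat.of k (I.fiber p ⧸ (K.fiber p).comap (I.fiber p).subtype)
  map {p q} h := ModuleCat.ofHom <| Submodule.mapQ _ _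
    ((M.map h).hom.restrict fun _ hx => I.map_le h (Submodule.mem_map_of_mem hx))
    fun _ hx => K.map_le h (Submodule.mem_map_of_mem hx)
  map_id p := by
    ext1
    refine Submodule.linearMap_qext _ (LinearMap.ext fun x => ?_)
    simp only [ModuleCat.hom_ofHom, LinearMap.comp_apply, Submodule.mkQ_apply,
      Submodule.mapQ_apply, ModuleCat.hom_id, LinearMap.id_apply]
    congr 1
    ext
    simp
  map_comp f g := by
    ext1
    refine Submodule.linearMap_qext _ (LinearMap.ext fun x => ?_)
    simp only [ModuleCat.hom_ofHom, LinearMap.comp_apply, Submodule.mkQ_apply,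
      Submodule.mapQ_apply, ModuleCat.hom_comp]
    congr 1
    ext
    simp

/-- The `ε`-pruning `Pru_ε(M) = (I / K)(-ε)` of `M`. -/
def pruning (ε : ℝ≥0) (M : PersMod k d) : PersMod k d :=
  shift (-(ε : ℝ)) (subquot (pruningUpper ε M) (pruningLower ε M))

/-! ### Pruning distance -/

/-- `N` is a subquotient of `M`: `N ≅ I / K` for submodules `K ⊆ I ⊆ M`. -/
def IsSubquotient (N M : PersMod k d) : Prop :=
  ∃ I K : Sub M, K ≤ I ∧ Nonempty (N ≅ subquot I K)

/-- `N` is an `∞`-refinement of `M`: for `M ≅ ⨁ Q i` with all `Q i` indecomposable, `N` is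
isomorphic to some `⨁ R i` with `R i` a subquotient of `Q i` for each `i`. -/
def InftyRefinement (N M : PersMod k d) : Prop :=
  ∃ (ι : Type u) (Q R : ι → PersMod k d),
    IsBarcode Q M ∧ (∀ i, IsSubquotient (R i) (Q i)) ∧ Nonempty (N ≅ dirSum R)

/-- The pruning distance, with value `∞` if the set of admissible `ε` is empty. -/
def pruningDist (M N : PersMod k d) : ℝ≥0∞ :=
  ⨅ (ε : ℝ≥0) (_ : ∀ δ : ℝ≥0,
    InftyRefinement (pruning (ε + δ) M) (pruning δ N) ∧
    InftyRefinement (pruning (ε + δ) N) (pruning δ M)), (ε : ℝ≥0∞)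

end Persistence

end

noncomputable section

namespace Persistence

variable {k : Type u} [Field k] {d : ℕ}

/-! ### Upset modules in coordinates -/

/-! Structure maps of an upset-decomposable module are injective, and any two points of `Pt d` have
a common upper bound. So the whole module sits in one space `ι →₀ k`, and a morphism is a single
matrix whose entry at `(i, j)` can be nonzero only if `W i ⊆ W' j`. Everything about modules becomes
a statement about inclusions of upsets: barcodes are unique (`exists_iso_of_retract`,
`exists_injective`), an `ε`-interleaving of upset modules means `U ⊆ V(ε)` and `V ⊆ U(ε)`, and no
nonzero summand can stay unmatched.

The pruning is explicit as well. Draw an edge from `i` to `j` when `U i ⊆ U j (2ε)`. The lower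
submodule is zero, and the upper one is the sum of the upset modules of the intersections of all `U
j` reachable from `i` (`mem_pruningUpper_iff`).

For `d_P ≤ d_B`: an `ε`-matching turns `δ`-edges for `N` into `(ε + δ)`-edges for `M`, so the larger
pruning intersects over more upsets and is contained in the smaller one, summand by summand
(`prunedUpset_subset`).

For the reverse bound only `δ = 0` is needed. The refinements give injections `τ` and `ρ` between
the barcodes, with pruned upsets contained in `ε`-shifts of their images. A barcode has at most `r`
members, because finitely many nonempty upsets share a point. Now fix `p` and record which upsets
contain its successive shifts. Each shift by `2ε` adds a new upset unless the recorded set is closed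
under edges; once it is closed, the pruning inclusions apply. A set of at most `r` members grows at
most `r - 1` times, and one further `ε` is spent on passing between `M` and `N`, giving `2(r - 1) +
1 = 2r - 1`. From `U i` to `V (τ i)` this is immediate (`reflTransGen_mem_of_growth`). In the other
direction `ρ ∘ τ` need not be the identity, and the count alternates between the two barcodes
(`mem_of_alternating_growth`). Thus the injection `τ` itself is the matching. -/

/-- Coordinates identifying a persistence module with the direct sum of the upset modules of the
family `W`: each `X_p` is embedded in `ι →₀ k`, compatibly with the structure maps, with image the
vectors supported on `{i | p ∈ W i}`. -/
structure UpsetCoords (X : PersMod k d) {ι : Type u} (W : ι → UpperSet (Pt d)) where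
  coord : ∀ p : Pt d, X.obj p →ₗ[k] ι →₀ k
  coord_map : ∀ {p q : Pt d} (h : p ⟶ q) (x : X.obj p),
    coord q ((X.map h).hom x) = coord p x
  coord_injective : ∀ p, Function.Injective (coord p)
  exists_coord_eq : ∀ (p : Pt d) (y : ι →₀ k), (∀ i, y i ≠ 0 → p ∈ W i) → ∃ x, coord p x = y
  mem_of_coord_ne_zero : ∀ {p : Pt d} {x : X.obj p} {i : ι}, coord p x i ≠ 0 → p ∈ W i

/-- The upset `U(ε) = {p | p + ε ∈ U}`. -/
def shiftUpper (ε : ℝ) (U : UpperSet (Pt d)) : UpperSet (Pt d) where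
  carrier := {p | shiftPt ε p ∈ U}
  upper' _ _ h hp := U.upper (shiftPt_mono ε h) hp

theorem mem_shiftUpper {ε : ℝ} {U : UpperSet (Pt d)} {p : Pt d} :
    p ∈ shiftUpper ε U ↔ shiftPt ε p ∈ U := Iff.rfl

theorem shiftPt_shiftPt (a b : ℝ) (p : Pt d) : shiftPt a (shiftPt b p) = shiftPt (a + b) p :=
  funext fun i => by simp only [shiftPt]; ring

theorem shiftPt_zero (p : Pt d) : shiftPt 0 p = p := funext fun i => by simp [shiftPt]

theorem exists_common_upper (p q : Pt d) : ∃ s : Pt d, p ≤ s ∧ q ≤ s :=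
  ⟨fun i => max (p i) (q i), fun i => le_max_left (p i) (q i), fun i => le_max_right (p i) (q i)⟩

namespace UpsetCoords

variable {X Y : PersMod k d} {ι κ : Type u} {W : ι → UpperSet (Pt d)}
  {W' : κ → UpperSet (Pt d)}

/-- The coordinates of a shifted module. -/
def shift (a : UpsetCoords X W) (ε : ℝ) :
    UpsetCoords (shift ε X) fun i => shiftUpper ε (W i) where
  coord p := a.coord (shiftPt ε p)
  coord_map h x := a.coord_map ((shiftPt_mono ε).functor.map h) x
  coord_injective _ := a.coord_injective _
  exists_coord_eq _ y hy := a.exists_coord_eq _ y hy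
  mem_of_coord_ne_zero h := a.mem_of_coord_ne_zero h

/-- Transport of coordinates along an isomorphism. -/
def ofIso (a : UpsetCoords X W) (θ : Y ≅ X) : UpsetCoords Y W where
  coord p := a.coord p ∘ₗ (θ.hom.app p).hom
  coord_map {p q} h x := by
    have : (θ.hom.app q).hom ((Y.map h).hom x) = (X.map h).hom ((θ.hom.app p).hom x) := by
      rw [← LinearMap.comp_apply, ← ModuleCat.hom_comp, θ.hom.naturality h]; rfl
    rw [LinearMap.comp_apply, this, a.coord_map]; rfl
  coord_injective p := (a.coord_injective p).comp (θ.app p).toLinearEquiv.injective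
  exists_coord_eq p y hy := by
    obtain ⟨x, hx⟩ := a.exists_coord_eq p y hy
    obtain ⟨x', rfl⟩ := (θ.app p).toLinearEquiv.surjective x
    exact ⟨x', hx⟩
  mem_of_coord_ne_zero h := a.mem_of_coord_ne_zero h

/-- Coordinates with respect to a smaller index type that misses only empty upsets. -/
def reindex (a : UpsetCoords X W) (f : κ → ι) (hf : f.Injective)
    (hW : ∀ i ∉ Set.range f, ∀ p, p ∉ W i) : UpsetCoords X fun j => W (f j) where
  coord p := Finsupp.lcomapDomain f hf ∘ₗ a.coord p
  coord_map h x := by rw [LinearMap.comp_apply, a.coord_map]; rfl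
  coord_injective p x y h := by
    refine a.coord_injective p (Finsupp.ext fun i => ?_)
    by_cases hi : i ∈ Set.range f
    · obtain ⟨j, rfl⟩ := hi
      exact DFunLike.congr_fun h j
    · rw [not_not.1 fun h => hW i hi p (a.mem_of_coord_ne_zero h),
        not_not.1 fun h => hW i hi p (a.mem_of_coord_ne_zero h)]
  exists_coord_eq p y hy := by
    obtain ⟨x, hx⟩ := a.exists_coord_eq p (Finsupp.embDomain ⟨f, hf⟩ y) (fun i hi => by
      by_cases h : i ∈ Set.range f
      · obtain ⟨j, rfl⟩ := h
        have : Finsupp.embDomain ⟨f, hf⟩ y (f j) = y j := Finsupp.embDomain_apply_self ⟨f, hf⟩ y j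
        exact hy j (this ▸ hi)
      · exact absurd (Finsupp.embDomain_of_notMem_range ⟨f, hf⟩ y i h) hi)
    refine ⟨x, Finsupp.ext fun j => ?_⟩
    rw [LinearMap.comp_apply, hx]
    exact Finsupp.embDomain_apply_self ⟨f, hf⟩ y j
  mem_of_coord_ne_zero h := a.mem_of_coord_ne_zero h

theorem map_injective (a : UpsetCoords X W) {p q : Pt d} (h : p ⟶ q) :
    Function.Injective (X.map h).hom := fun x y hxy =>
  a.coord_injective p <| by rw [← a.coord_map h, ← a.coord_map h, hxy]

theorem hom_ext (b : UpsetCoords Y W') {f g : X ⟶ Y}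
    (h : ∀ p x, b.coord p ((f.app p).hom x) = b.coord p ((g.app p).hom x)) : f = g := by
  ext p x
  exact b.coord_injective p (h p x)

/-- A matrix that respects the supports defines a morphism. -/
theorem exists_hom (a : UpsetCoords X W) (b : UpsetCoords Y W')
    (F : (ι →₀ k) →ₗ[k] (κ →₀ k))
    (hF : ∀ p x j, F (a.coord p x) j ≠ 0 → p ∈ W' j) :
    ∃ f : X ⟶ Y, ∀ p x, b.coord p ((f.app p).hom x) = F (a.coord p x) := by
  choose g hg using fun p x => b.exists_coord_eq p (F (a.coord p x)) (hF p x)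
  refine ⟨{ app := fun p => ModuleCat.ofHom
              { toFun := g p
                map_add' := fun x y => b.coord_injective p (by simp [hg])
                map_smul' := fun c x => b.coord_injective p (by simp [hg]) }
            naturality := fun p q h => ?_ }, fun p x => hg p x⟩
  ext x
  apply b.coord_injective q
  change b.coord q (g q ((X.map h).hom x)) = b.coord q ((Y.map h).hom (g p x))
  rw [hg, b.coord_map, hg, a.coord_map]

theorem exists_coord_eq_single (a : UpsetCoords X W) {p : Pt d} {i : ι} (hp : p ∈ W i) :
    ∃ x, a.coord p x = Finsupp.single i 1 := by
  classical
  refine a.exists_coord_eq p _ fun i' hi' => ?_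
  by_cases h : i = i'
  · exact h ▸ hp
  · simp [h] at hi'

theorem exists_eq_sum (a : UpsetCoords X W) {p : Pt d} (x : X.obj p) : ∃ e : ι → X.obj p,
    (∀ i, a.coord p x i ≠ 0 → a.coord p (e i) = Finsupp.single i 1) ∧
      x = ∑ i ∈ (a.coord p x).support, a.coord p x i • e i := by
  -- Outside the support, `p` need not lie in `W i` and there may be no basis vector; `0` is a
  -- harmless default there.
  have he : ∀ i, ∃ e : X.obj p, a.coord p x i ≠ 0 → a.coord p e = Finsupp.single i 1 :=
    fun i => by
      by_cases hi : a.coord p x i = 0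
      · exact ⟨0, fun h => absurd hi h⟩
      · exact (a.exists_coord_eq_single (a.mem_of_coord_ne_zero hi)).imp fun _ h _ => h
  choose e he using he
  refine ⟨e, he, a.coord_injective p ?_⟩
  conv_lhs => rw [← Finsupp.sum_single (a.coord p x)]
  rw [Finsupp.sum, map_sum]
  refine Finset.sum_congr rfl fun i hi => ?_
  rw [map_smul, he i (Finsupp.mem_support_iff.1 hi)]
  simp

/-- Every morphism is given by a matrix, whose entry at `(i, j)` vanishes unless
`W i ⊆ W' j`. -/
theorem exists_matrix (a : UpsetCoords X W) (b : UpsetCoords Y W') (f : X ⟶ Y) :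
    ∃ F : (ι →₀ k) →ₗ[k] (κ →₀ k), (∀ p x, b.coord p ((f.app p).hom x) = F (a.coord p x)) ∧
      ∀ i j, F (Finsupp.single i 1) j ≠ 0 → ∀ p ∈ W i, p ∈ W' j := by
  have hmap : ∀ {p q : Pt d} (h : p ≤ q) (x : X.obj p),
      b.coord q ((f.app q).hom ((X.map (homOfLE h)).hom x)) = b.coord p ((f.app p).hom x) := by
    intro p q h x
    have : (f.app q).hom ((X.map (homOfLE h)).hom x)
        = (Y.map (homOfLE h)).hom ((f.app p).hom x) := by
      rw [← LinearMap.comp_apply, ← ModuleCat.hom_comp, f.naturality]; rfl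
    rw [this, b.coord_map]
  have hv : ∀ i, ∃ v : κ →₀ k, ∀ p ∈ W i, ∀ x, a.coord p x = Finsupp.single i 1 →
      b.coord p ((f.app p).hom x) = v := by
    intro i
    by_cases h : ∃ p, p ∈ W i
    · obtain ⟨p, hp⟩ := h
      obtain ⟨x, hx⟩ := a.exists_coord_eq_single hp
      refine ⟨b.coord p ((f.app p).hom x), fun q _ y hy => ?_⟩
      -- Coordinates are constant along structure maps, so comparing at a common upper bound shows
      -- that the matrix column does not depend on the point.
      obtain ⟨s, hps, hqs⟩ := exists_common_upper p q
      rw [← hmap hps, ← hmap hqs]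
      congr 2
      apply a.coord_injective s
      rw [a.coord_map, a.coord_map, hx, hy]
    · exact ⟨0, fun p hp => absurd ⟨p, hp⟩ h⟩
  choose v hv using hv
  refine ⟨Finsupp.linearCombination k v, fun p x => ?_, fun i j h p hp => ?_⟩
  · obtain ⟨e, he, hx⟩ := a.exists_eq_sum x
    rw [Finsupp.linearCombination_apply, Finsupp.sum]
    conv_lhs => rw [hx]
    rw [map_sum, map_sum]
    refine Finset.sum_congr rfl fun i hi => ?_
    have hi' := Finsupp.mem_support_iff.1 hi
    rw [map_smul, map_smul, hv i p (a.mem_of_coord_ne_zero hi') _ (he i hi')]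
  · rw [Finsupp.linearCombination_single, one_smul] at h
    obtain ⟨x, hx⟩ := a.exists_coord_eq_single hp
    rw [← hv i p hp x hx] at h
    exact b.mem_of_coord_ne_zero h

theorem exists_index_of_apply_ne_zero {F : (ι →₀ k) →ₗ[k] (κ →₀ k)} {y : ι →₀ k} {j : κ}
    (h : F y j ≠ 0) : ∃ i, y i ≠ 0 ∧ F (Finsupp.single i 1) j ≠ 0 := by
  by_contra! hc
  apply h
  conv_lhs => rw [← Finsupp.sum_single y]
  rw [Finsupp.sum, map_sum, Finsupp.finsetSum_apply]
  refine Finset.sum_eq_zero fun i hi => ?_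
  have : Finsupp.single i (y i) = y i • Finsupp.single i (1 : k) := by simp
  rw [this, map_smul, Finsupp.smul_apply, hc i (Finsupp.mem_support_iff.1 hi), smul_zero]

/-- The identity matrix respects the supports in both directions. -/
theorem nonempty_iso (a : UpsetCoords X W) (b : UpsetCoords Y W) : Nonempty (X ≅ Y) := by
  obtain ⟨f, hf⟩ := a.exists_hom b LinearMap.id fun _ _ _ h => a.mem_of_coord_ne_zero h
  obtain ⟨g, hg⟩ := b.exists_hom a LinearMap.id fun _ _ _ h => b.mem_of_coord_ne_zero h
  exact ⟨⟨f, g, a.hom_ext fun _ _ => (hg _ _).trans (hf _ _),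
    b.hom_ext fun _ _ => (hf _ _).trans (hg _ _)⟩⟩

/-- The coordinates on the fiber of a direct sum of upset modules. -/
def fiberCoord (W : ι → UpperSet (Pt d)) (p : Pt d) :
    (⨁ i, upsetFiber k (W i) p) →ₗ[k] ι →₀ k where
  toFun x := Finsupp.ofSupportFinite (fun i => (x i : k))
    ((DFinsupp.finite_support x).subset fun _ hi h => hi (congrArg Subtype.val h))
  map_add' _ _ := Finsupp.ext fun _ => rfl
  map_smul' _ _ := Finsupp.ext fun _ => rfl

theorem fiberCoord_injective (W : ι → UpperSet (Pt d)) (p : Pt d) :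
    Function.Injective (fiberCoord (k := k) W p) := fun _ _ h =>
  DFinsupp.ext fun i => Subtype.ext (DFunLike.congr_fun h i)

theorem exists_fiberCoord_eq (W : ι → UpperSet (Pt d)) (p : Pt d) (y : ι →₀ k)
    (hy : ∀ i, y i ≠ 0 → p ∈ W i) : ∃ x, fiberCoord W p x = y := by
  classical
  refine ⟨DFinsupp.mk (β := fun i => upsetFiber k (W i) p) y.support fun i =>
    ⟨y i, fun hi => not_not.1 fun h => hi (hy i h)⟩, Finsupp.ext fun i => ?_⟩
  change ((DFinsupp.mk (β := fun i => upsetFiber k (W i) p) y.support _ i :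
    upsetFiber k (W i) p) : k) = y i
  rw [DFinsupp.mk_apply]
  split_ifs with h
  · rfl
  · exact (Finsupp.notMem_support_iff.1 h).symm

theorem mem_of_fiberCoord_ne_zero {W : ι → UpperSet (Pt d)} {p : Pt d}
    (x : ⨁ i, upsetFiber k (W i) p) {i : ι} (h : fiberCoord W p x i ≠ 0) : p ∈ W i := by
  by_contra hp
  exact h ((x i).2 hp)

/-- The standard coordinates of a direct sum of upset modules. -/
def dirSum (W : ι → UpperSet (Pt d)) :
    UpsetCoords (dirSum fun i => upsetMod k (W i)) W where
  coord p := fiberCoord W p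
  coord_map _ _ := Finsupp.ext fun _ => rfl
  coord_injective p := fiberCoord_injective W p
  exists_coord_eq p y hy := exists_fiberCoord_eq W p y hy
  mem_of_coord_ne_zero {p x _} h := mem_of_fiberCoord_ne_zero (W := W) (p := p) x h

/-- The coordinate of a single upset module. -/
def single (U : UpperSet (Pt d)) : UpsetCoords (upsetMod k U) fun _ : PUnit.{u + 1} => U where
  coord p := Finsupp.lsingle PUnit.unit ∘ₗ (upsetFiber k U p).subtype
  coord_map _ _ := rfl
  coord_injective p x y h := Subtype.ext (Finsupp.single_injective _ h)
  exists_coord_eq p y hy :=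
    ⟨(⟨y PUnit.unit, fun hi => not_not.1 fun h => hi (hy _ h)⟩ : upsetFiber k U p),
      Finsupp.ext fun _ => Finsupp.single_eq_same⟩
  mem_of_coord_ne_zero {p x i} h := by
    by_contra hp
    have : ∀ x : upsetFiber k U p, Finsupp.single PUnit.unit.{u + 1} (x : k) i = 0 := fun x => by
      rw [x.2 hp, Finsupp.single_zero, Finsupp.zero_apply]
    exact h (this x)

end UpsetCoords

/-! ### Direct sums and their summands as retracts -/

/-- Direct sums of isomorphic families are isomorphic. -/
theorem nonempty_dirSum_iso {ι : Type u} {Q R : ι → PersMod k d}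
    (h : ∀ i, Nonempty (Q i ≅ R i)) : Nonempty (dirSum Q ≅ dirSum R) := by
  have θ := fun i => (h i).some
  refine ⟨NatIso.ofComponents (fun p => LinearEquiv.toModuleIso
    (DFinsupp.mapRange.linearEquiv fun i => ((θ i).app p).toLinearEquiv)) ?_⟩
  intro p q f
  ext1
  refine LinearMap.ext fun x => ?_
  have key : ∀ x : ⨁ i, (Q i).obj p,
      DirectSum.lmap (fun i => ((θ i).hom.app q).hom)
        (DirectSum.lmap (fun i => ((Q i).map f).hom) x) =
      DirectSum.lmap (fun i => ((R i).map f).hom)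
        (DirectSum.lmap (fun i => ((θ i).hom.app p).hom) x) := fun x =>
    DFinsupp.ext fun i =>
      LinearMap.congr_fun (congrArg ModuleCat.Hom.hom ((θ i).hom.naturality f)) (x i)
  exact key x

/-- The inclusion of a summand of a direct sum of persistence modules. -/
def dirSumIncl {ι : Type u} [DecidableEq ι] (Q : ι → PersMod k d) (i : ι) : Q i ⟶ dirSum Q where
  app p := ModuleCat.ofHom (DirectSum.lof k ι (fun i => (Q i).obj p) i)
  naturality p q f := by
    ext x
    exact (DirectSum.lmap_lof (fun i => ((Q i).map f).hom) i x).symm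

/-- The projection of a direct sum of persistence modules to a summand. -/
def dirSumProj {ι : Type u} (Q : ι → PersMod k d) (i : ι) : dirSum Q ⟶ Q i where
  app p := ModuleCat.ofHom (DirectSum.component k ι (fun i => (Q i).obj p) i)
  naturality _ _ _ := rfl

theorem dirSumIncl_proj {ι : Type u} [DecidableEq ι] (Q : ι → PersMod k d) (i : ι) :
    dirSumIncl Q i ≫ dirSumProj Q i = 𝟙 (Q i) := by
  ext p x
  exact DirectSum.component.lof_self k (M := fun i => (Q i).obj p) i x

/-! ### Decompositions into upset modules -/

open Limits in
/-- A nonzero retract of an indecomposable module is the whole module. -/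
theorem nonempty_iso_of_retract_of_indecomposable {Q X : PersMod k d} (hQ : Indecomposable Q)
    (hX : ¬ IsZero X) (f : X ⟶ Q) (g : Q ⟶ X) (h : f ≫ g = 𝟙 X) : Nonempty (X ≅ Q) := by
  have : IsSplitMono f := IsSplitMono.mk' ⟨g, h⟩
  have hb := isBilimitBinaryBiconeOfIsSplitMonoOfCokernel (cokernelIsCokernel f)
  have θ := biprod.uniqueUpToIso _ _ hb
  have hc : IsZero (cokernel f) := (hQ.2 X (cokernel f) θ).resolve_left hX
  have : Epi f := Preadditive.epi_of_cokernel_zero (hc.eq_of_tgt _ _)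
  have : IsIso f := isIso_of_epi_of_isSplitMono f
  exact ⟨asIso f⟩

theorem isZero_of_forall_eq_zero {X : PersMod k d} (h : ∀ p (x : X.obj p), x = 0) :
    Limits.IsZero X := by
  rw [Functor.isZero_iff]
  intro p
  have : Subsingleton (X.obj p) := ⟨fun x y => (h p x).trans (h p y).symm⟩
  exact ModuleCat.isZero_of_subsingleton _

theorem exists_ne_zero_of_not_isZero {X : PersMod k d} (h : ¬ Limits.IsZero X) :
    ∃ (p : Pt d) (x : X.obj p), x ≠ 0 := by
  by_contra! hc
  exact h (isZero_of_forall_eq_zero hc)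

namespace UpsetCoords

variable {X Y : PersMod k d} {ι κ : Type u} {W : ι → UpperSet (Pt d)}
  {W' : κ → UpperSet (Pt d)}

theorem not_isZero (a : UpsetCoords X W) {p : Pt d} {i : ι} (hp : p ∈ W i) :
    ¬ Limits.IsZero X := by
  intro h
  obtain ⟨x, hx⟩ := a.exists_coord_eq_single hp
  have hp := (Functor.isZero_iff X).1 h p
  have : x = 0 := by
    have := congrArg ModuleCat.Hom.hom (hp.eq_of_src (𝟙 (X.obj p)) 0)
    exact LinearMap.congr_fun this x
  rw [this, map_zero] at hx
  exact one_ne_zero (Finsupp.single_eq_zero.1 hx.symm)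

theorem exists_mem_of_not_isZero (a : UpsetCoords X W) (h : ¬ Limits.IsZero X) :
    ∃ i p, p ∈ W i := by
  obtain ⟨p, x, hx⟩ := exists_ne_zero_of_not_isZero h
  have : a.coord p x ≠ 0 := fun h => hx (a.coord_injective p (h.trans (map_zero _).symm))
  obtain ⟨i, hi⟩ := Finsupp.ne_iff.1 this
  exact ⟨i, p, a.mem_of_coord_ne_zero hi⟩

/-- An indecomposable retract of a direct sum of upset modules is one of these. -/
theorem exists_iso_of_retract (a : UpsetCoords X W) {Q : PersMod k d} (hQ : Indecomposable Q)
    (s : Q ⟶ X) (π : X ⟶ Q) (h : s ≫ π = 𝟙 Q) : ∃ i, Nonempty (upsetMod k (W i) ≅ Q) := by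
  classical
  obtain ⟨p, x, hx⟩ := exists_ne_zero_of_not_isZero hQ.1
  obtain ⟨F, hF, hFW⟩ := a.exists_matrix a (π ≫ s)
  set y := a.coord p ((s.app p).hom x) with hy
  have hπs : ∀ x : Q.obj p, (π.app p).hom ((s.app p).hom x) = x := fun x => by
    rw [← LinearMap.comp_apply, ← ModuleCat.hom_comp, ← NatTrans.comp_app, h]; rfl
  have hFy : F y = y := by
    rw [hy, ← hF, NatTrans.comp_app, ModuleCat.hom_comp, LinearMap.comp_apply, hπs]
  have hy0 : y ≠ 0 := fun h0 => hx <| by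
    have : (s.app p).hom x = 0 := a.coord_injective p (h0.trans (map_zero _).symm)
    rw [← hπs x, this, map_zero]
  -- The vector `y` is fixed by the idempotent matrix `F`. A minimal upset in its support can only
  -- be fed by an index `i'` of the support with the same upset, so `F` has a nonzero entry `c`
  -- between two equal upsets. Hence the upset module of `W i` passes through `Q` with composite
  -- `c`, and is a retract of `Q`.
  obtain ⟨i, hi, hmin⟩ := y.support.exists_minimalFor (fun i => (W i : Set (Pt d)))
    (Finsupp.support_nonempty_iff.2 hy0)
  rw [Finsupp.mem_support_iff] at hi
  have hFi : F y i ≠ 0 := by rwa [hFy]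
  obtain ⟨i', hi', hFi'⟩ := exists_index_of_apply_ne_zero hFi
  have hWle : (W i' : Set (Pt d)) ⊆ W i := fun q hq => hFW i' i hFi' q hq
  have hWeq : W i' = W i :=
    SetLike.coe_injective (hWle.antisymm (hmin (Finsupp.mem_support_iff.2 hi') hWle))
  have hpi : p ∈ W i := a.mem_of_coord_ne_zero hi
  refine ⟨i, ?_⟩
  let b := single (k := k) (W i)
  obtain ⟨f, hf⟩ := b.exists_hom a (Finsupp.lsingle i' ∘ₗ Finsupp.lapply PUnit.unit)
    fun q z j hj => by
      by_cases h : i' = j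
      · subst h
        rw [hWeq]
        refine b.mem_of_coord_ne_zero (x := z) (i := PUnit.unit) ?_
        simpa using hj
      · simp [h] at hj
  obtain ⟨g, hg⟩ := a.exists_hom b (Finsupp.lsingle PUnit.unit ∘ₗ Finsupp.lapply i)
    fun q z j hj => a.mem_of_coord_ne_zero (x := z) (i := i) (by simpa using hj)
  set c := F (Finsupp.single i' 1) i with hc
  have key : (f ≫ π) ≫ (s ≫ g) = c • 𝟙 _ := by
    refine b.hom_ext fun q z => ?_
    have e1 : ((((f ≫ π) ≫ (s ≫ g)).app q).hom z) =
        (g.app q).hom (((π ≫ s).app q).hom ((f.app q).hom z)) := rfl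
    rw [e1, hg, hF, hf]
    have e2 : ((c • 𝟙 (upsetMod k (W i)) : upsetMod k (W i) ⟶ _).app q).hom z = c • z := rfl
    rw [e2, map_smul]
    have hFt : ∀ t : k, F (Finsupp.single i' t) i = c * t := fun t => by
      have : Finsupp.single i' t = t • Finsupp.single i' (1 : k) := by simp
      rw [this, map_smul, Finsupp.smul_apply, smul_eq_mul, mul_comm]
    refine Finsupp.ext fun _ => ?_
    simp only [LinearMap.comp_apply, Finsupp.lapply_apply, Finsupp.lsingle_apply, hFt]
    simp
  refine nonempty_iso_of_retract_of_indecomposable hQ (b.not_isZero (i := PUnit.unit) hpi)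
    (f ≫ π) (c⁻¹ • (s ≫ g)) ?_
  rw [Linear.comp_smul, key, smul_smul, inv_mul_cancel₀ hFi', one_smul]

/-- Endomorphisms are scalars. The projection to a summand is therefore a scalar `c`: if `c = 0`
that summand vanishes, and otherwise the complementary one does. -/
theorem indecomposable_upsetMod {U : UpperSet (Pt d)} {p : Pt d} (hp : p ∈ U) :
    Indecomposable (upsetMod k U) := by
  let b := single (k := k) U
  refine ⟨b.not_isZero (i := PUnit.unit) hp, fun Y Z θ => ?_⟩
  set e := θ.hom ≫ Limits.biprod.fst ≫ Limits.biprod.inl ≫ θ.inv with he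
  obtain ⟨F, hF, -⟩ := b.exists_matrix b e
  set c := F (Finsupp.single PUnit.unit 1) PUnit.unit with hc
  have hFc : ∀ y, F y = c • y := fun y => by
    have : y = y PUnit.unit • Finsupp.single PUnit.unit (1 : k) := Finsupp.ext fun _ => by simp
    conv_lhs => rw [this]
    rw [map_smul]
    refine Finsupp.ext fun _ => ?_
    simp [← hc, mul_comm]
  have hec : e = c • 𝟙 _ := by
    refine b.hom_ext fun q z => ?_
    rw [hF, hFc]
    exact (map_smul _ _ _).symm
  have hY : Limits.biprod.inl ≫ θ.inv ≫ e ≫ θ.hom ≫ Limits.biprod.fst = 𝟙 Y := by simp [he]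
  have hZ : Limits.biprod.inr ≫ θ.inv ≫ e ≫ θ.hom ≫ Limits.biprod.snd = 0 := by simp [he]
  by_cases hc0 : c = 0
  · left
    rw [Limits.IsZero.iff_id_eq_zero, ← hY, hec, hc0]
    simp
  · right
    rw [Limits.IsZero.iff_id_eq_zero]
    simp only [hec, Linear.smul_comp, Linear.comp_smul, Category.id_comp, Iso.inv_hom_id_assoc,
      Limits.biprod.inr_snd] at hZ
    exact (smul_eq_zero.1 hZ).resolve_left hc0

/-- The upsets in a decomposition of a module occur in every other decomposition of it, with at
least the same multiplicity. -/
theorem exists_injective (a : UpsetCoords X W) (b : UpsetCoords X W')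
    (hW : ∀ i, ∃ p, p ∈ W i) : ∃ f : ι → κ, f.Injective ∧ ∀ i, W' (f i) = W i := by
  classical
  obtain ⟨F, hF, hFW⟩ := a.exists_matrix b (𝟙 X)
  obtain ⟨G, hG, hGW⟩ := b.exists_matrix a (𝟙 X)
  -- For each upset `U`, the block of `F` between the indices carrying `U` on both sides is
  -- injective. Comparing ranks then gives an embedding of index sets, with no finiteness needed.
  have hemb : ∀ U, Nonempty ({i // W i = U} ↪ {j // W' j = U}) := by
    intro U
    by_cases hU : ∃ i, W i = U
    swap
    · have : IsEmpty {i // W i = U} := ⟨fun i => hU ⟨i.1, i.2⟩⟩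
      exact ⟨⟨isEmptyElim, isEmptyElim⟩⟩
    obtain ⟨i₀, hi₀⟩ := hU
    obtain ⟨p, hp⟩ := hW i₀
    rw [hi₀] at hp
    let L : ({i // W i = U} →₀ k) →ₗ[k] ({j // W' j = U} →₀ k) :=
      Finsupp.lcomapDomain Subtype.val Subtype.val_injective ∘ₗ F ∘ₗ
        Finsupp.lmapDomain k k Subtype.val
    have hL : Function.Injective L := by
      rw [injective_iff_map_eq_zero]
      intro x hx
      set z := Finsupp.mapDomain Subtype.val x with hz
      have hzs : ∀ i, z i ≠ 0 → W i = U := fun i hi => by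
        by_contra h
        exact hi (Finsupp.mapDomain_of_notMem_range x i (by simpa using h))
      have hy : ∀ j, W' j = U → F z j = 0 := fun j hj => DFunLike.congr_fun hx ⟨j, hj⟩
      obtain ⟨w, hw⟩ := a.exists_coord_eq p z fun i hi => (hzs i hi).symm ▸ hp
      have hGF : G (F z) = z := by
        rw [← hw, ← hF, ← hG]; rfl
      have hz0 : z = 0 := by
        refine Finsupp.ext fun i => ?_
        by_contra hi
        change z i ≠ 0 at hi
        have hi' := hi
        rw [← hGF] at hi'
        -- Since `G F z = z`, some path `i' → j → i` starts and ends at the upset `U`. The two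
        -- inclusions force `W' j = U`, but `F z` was assumed to vanish on that block.
        obtain ⟨j, hj, hji⟩ := exists_index_of_apply_ne_zero hi'
        obtain ⟨i', hi', hij⟩ := exists_index_of_apply_ne_zero hj
        refine hj (hy j (SetLike.coe_injective (Set.Subset.antisymm ?_ ?_)))
        · exact fun q hq => hzs i hi ▸ hGW j i hji q hq
        · exact fun q hq => hFW i' j hij q ((hzs i' hi').symm ▸ hq)
      exact Finsupp.mapDomain_injective Subtype.val_injective
        (hz0.trans Finsupp.mapDomain_zero.symm)
    have := LinearMap.rank_le_of_injective L hL
    rwa [rank_finsupp_self', rank_finsupp_self'] at this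
  have e := fun U => (hemb U).some
  refine ⟨fun i => (e (W i) ⟨i, rfl⟩).1, fun i i' h => ?_, fun i => (e (W i) ⟨i, rfl⟩).2⟩
  have hinj := (((Equiv.sigmaFiberEquiv W).symm.toEmbedding.trans
    (Function.Embedding.sigmaMap (Function.Embedding.refl _) e)).trans
    (Equiv.sigmaFiberEquiv W').toEmbedding).injective
  exact hinj h

end UpsetCoords

/-! ### Interleavings of upset modules -/

theorem Interleaved.symm {ε : ℝ≥0} {X Y : PersMod k d} (h : Interleaved ε X Y) :
    Interleaved ε Y X := by
  obtain ⟨φ, ψ, h₁, h₂⟩ := h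
  exact ⟨ψ, φ, h₂, h₁⟩

namespace UpsetCoords

variable {X Y : PersMod k d} {ι κ : Type u} {W : ι → UpperSet (Pt d)}
  {W' : κ → UpperSet (Pt d)}

/-- A generator at `p` survives to `p + 2ε` because structure maps are injective. Its image under
`φ` is then nonzero, so the fiber of `Y` at `p + ε` is nonzero. -/
theorem shiftPt_mem_of_interleaved {ε : ℝ≥0} {U V : UpperSet (Pt d)}
    (a : UpsetCoords X fun _ : PUnit.{u + 1} => U) (b : UpsetCoords Y fun _ : PUnit.{u + 1} => V)
    (h : Interleaved ε X Y) {p : Pt d} (hp : p ∈ U) : shiftPt ε p ∈ V := by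
  obtain ⟨φ, ψ, h₁, -⟩ := h
  obtain ⟨x, hx⟩ := a.exists_coord_eq_single (i := PUnit.unit) hp
  have hφ : (b.shift ε).coord p ((φ.app p).hom x) ≠ 0 := by
    intro h0
    have h0' : (φ.app p).hom x = 0 :=
      (b.shift ε).coord_injective p (h0.trans (map_zero _).symm)
    have h2 : (X.map (homOfLE ((le_shiftPt ε.2 p).trans (le_shiftPt ε.2 (shiftPt ε p))))).hom x
        = 0 := by
      have h2 := LinearMap.congr_fun (congrArg ModuleCat.Hom.hom (h₁ p)) x
      exact h2.symm.trans ((congrArg (ψ.app (shiftPt ε p)).hom h0').trans (map_zero _))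
    have h3 := a.coord_map (homOfLE ((le_shiftPt ε.2 p).trans (le_shiftPt ε.2 (shiftPt ε p)))) x
    rw [h2, map_zero, hx] at h3
    exact one_ne_zero (Finsupp.single_eq_zero.1 h3.symm)
  obtain ⟨i, hi⟩ := Finsupp.ne_iff.1 hφ
  exact (b.shift ε).mem_of_coord_ne_zero hi

/-- The structure map over `2ε` factors through zero and is injective. This excludes unmatched
summands. -/
theorem isZero_of_interleaved_zeroMod {ε : ℝ≥0} (a : UpsetCoords X W)
    (h : Interleaved ε X zeroMod) : Limits.IsZero X := by
  obtain ⟨φ, ψ, h₁, -⟩ := h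
  refine isZero_of_forall_eq_zero fun p x => ?_
  apply a.map_injective (homOfLE ((le_shiftPt ε.2 p).trans (le_shiftPt ε.2 (shiftPt ε p))))
  have h0 : (φ.app p).hom x = 0 := Subsingleton.elim (α := PUnit) _ _
  have h2 := LinearMap.congr_fun (congrArg ModuleCat.Hom.hom (h₁ p)) x
  rw [map_zero]
  exact h2.symm.trans ((congrArg (ψ.app (shiftPt ε p)).hom h0).trans (map_zero _))

theorem interleaved {ε : ℝ≥0} {W' : ι → UpperSet (Pt d)} (a : UpsetCoords X W)
    (b : UpsetCoords Y W') (h : ∀ i, ∀ p ∈ W i, shiftPt ε p ∈ W' i)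
    (h' : ∀ i, ∀ p ∈ W' i, shiftPt ε p ∈ W i) : Interleaved ε X Y := by
  obtain ⟨φ, hφ⟩ := a.exists_hom (b.shift ε) LinearMap.id
    fun p x j hj => h j p (a.mem_of_coord_ne_zero hj)
  obtain ⟨ψ, hψ⟩ := b.exists_hom (a.shift ε) LinearMap.id
    fun p x j hj => h' j p (b.mem_of_coord_ne_zero hj)
  refine ⟨φ, ψ, fun p => ?_, fun p => ?_⟩
  · ext x
    apply a.coord_injective
    exact ((hψ _ _).trans (hφ _ _)).trans (a.coord_map _ x).symm
  · ext x
    apply b.coord_injective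
    exact ((hφ _ _).trans (hψ _ _)).trans (b.coord_map _ x).symm

/-! ### Subquotients -/

/-- The coordinates of a submodule that is spanned by coordinate vectors (written as a
subquotient by the zero submodule). -/
def subquot (a : UpsetCoords X W) (I K : Sub X) (C : ι → UpperSet (Pt d))
    (hI : ∀ p x, x ∈ I.fiber p ↔ ∀ i, a.coord p x i ≠ 0 → p ∈ C i)
    (hC : ∀ i, ∀ p ∈ C i, p ∈ W i) (hK : ∀ p, K.fiber p = ⊥) :
    UpsetCoords (subquot I K) C where
  coord p := ((K.fiber p).comap (I.fiber p).subtype).liftQ (a.coord p ∘ₗ (I.fiber p).subtype)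
    fun x hx => by
      rw [hK, Submodule.mem_comap, Submodule.mem_bot] at hx
      rw [LinearMap.mem_ker, LinearMap.comp_apply, hx, map_zero]
  coord_map {p q} h x := by
    obtain ⟨x, rfl⟩ := Submodule.mkQ_surjective _ x
    exact a.coord_map h (x : X.obj p)
  coord_injective p := by
    refine LinearMap.ker_eq_bot.1 (Submodule.ker_liftQ_eq_bot _ _ _ fun x hx => ?_)
    have : (x : X.obj p) = 0 := a.coord_injective p ((LinearMap.mem_ker.1 hx).trans
      (map_zero _).symm)
    rw [Submodule.mem_comap, Submodule.subtype_apply, this]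
    exact zero_mem _
  exists_coord_eq p y hy := by
    obtain ⟨x, hx⟩ := a.exists_coord_eq p y fun i hi => hC i p (hy i hi)
    exact ⟨Submodule.Quotient.mk ⟨x, (hI p x).2 (hx.symm ▸ hy)⟩, hx⟩
  mem_of_coord_ne_zero {p x i} h := by
    obtain ⟨x, rfl⟩ := Submodule.mkQ_surjective _ x
    exact (hI p x).1 x.2 i h

end UpsetCoords

/-- The zero submodule. -/
def botSub (X : PersMod k d) : Sub X where
  fiber _ := ⊥
  map_le _ := by rw [Submodule.map_bot]

theorem isSubquotient_upsetMod {A B : UpperSet (Pt d)} (h : ∀ p ∈ A, p ∈ B) :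
    IsSubquotient (upsetMod k A) (upsetMod k B) := by
  let b := UpsetCoords.single (k := k) B
  let I : Sub (upsetMod k B) :=
    { fiber := fun p => (upsetFiber k A p).comap (upsetFiber k B p).subtype
      map_le := fun {p q} f => by
        rintro _ ⟨x, hx, rfl⟩
        exact upsetFiber_mono A (leOfHom f) hx }
  refine ⟨I, botSub _, fun p => bot_le, ?_⟩
  refine (UpsetCoords.single A).nonempty_iso
    (b.subquot I (botSub _) (fun _ => A) (fun p x => ?_) (fun _ => h) fun _ => rfl)
  have key : ∀ x : upsetFiber k B p, (p ∉ A → (x : k) = 0) ↔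
      ∀ i : PUnit.{u + 1}, Finsupp.single PUnit.unit (x : k) i ≠ 0 → p ∈ A := fun x =>
    ⟨fun h _ hne => not_not.1 fun hp => hne (by rw [h hp, Finsupp.single_zero]; rfl),
      fun h hp => not_not.1 fun hne => hp (h PUnit.unit (by rwa [Finsupp.single_eq_same]))⟩
  exact key x

/-- A subquotient of an upset module with injective structure maps is an upset module. -/
theorem exists_upsetCoords_of_isSubquotient {R Q : PersMod k d} {B : UpperSet (Pt d)}
    (b : UpsetCoords Q fun _ : PUnit.{u + 1} => B) (hR : IsSubquotient R Q)
    (hinj : ∀ {p q : Pt d} (h : p ⟶ q), Function.Injective (R.map h).hom) :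
    ∃ A : UpperSet (Pt d), (∀ p ∈ A, p ∈ B) ∧
      Nonempty (UpsetCoords R fun _ : PUnit.{u + 1} => A) := by
  obtain ⟨I, K, -, ⟨θ⟩⟩ := hR
  have hinj' : ∀ {p q : Pt d} (h : p ⟶ q) (x : Q.obj p), x ∈ I.fiber p →
      (Q.map h).hom x ∈ K.fiber q → x ∈ K.fiber p := by
    intro p q h x hx hxK
    have hs : Function.Injective ((subquot I K).map h).hom := by
      rw [← NatIso.naturality_1 θ h]
      exact ((θ.app q).toLinearEquiv.injective.comp (hinj h)).comp
        (θ.app p).toLinearEquiv.symm.injective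
    let x' : (subquot I K).obj p :=
      Submodule.Quotient.mk (p := (K.fiber p).comap (I.fiber p).subtype) ⟨x, hx⟩
    have h0 : ((subquot I K).map h).hom x' = 0 :=
      (Submodule.Quotient.mk_eq_zero ((K.fiber q).comap (I.fiber q).subtype)).2 hxK
    have h1 : x' = 0 := hs (h0.trans (map_zero _).symm)
    exact (Submodule.Quotient.mk_eq_zero ((K.fiber p).comap (I.fiber p).subtype)).1 h1
  have hdim : ∀ p (S : Submodule k (Q.obj p)) (x y : Q.obj p), x ∈ S → x ≠ 0 → y ∈ S := by
    intro p S x y hx hx0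
    have hc : b.coord p x PUnit.unit ≠ 0 := fun h0 => hx0 <| b.coord_injective p <|
      Finsupp.ext fun _ => by rw [(b.coord p).map_zero]; exact h0
    have : y = (b.coord p y PUnit.unit / b.coord p x PUnit.unit) • x :=
      b.coord_injective p <| Finsupp.ext fun _ => by
        rw [(b.coord p).map_smul, Finsupp.smul_apply, smul_eq_mul]; exact (div_mul_cancel₀ _ hc).symm
    exact this ▸ S.smul_mem _ hx
  -- `A` is the support of `I / K`; it is upward closed because the structure maps of `R` are
  -- injective.
  let A : UpperSet (Pt d) :=
    { carrier := {p | ∃ x ∈ I.fiber p, x ∉ K.fiber p}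
      upper' := by
        rintro p q h ⟨x, hx, hxK⟩
        exact ⟨(Q.map (homOfLE h)).hom x, I.map_le _ (Submodule.mem_map_of_mem hx),
          fun hK => hxK (hinj' _ x hx hK)⟩ }
  have hAmem : ∀ {p}, p ∈ A ↔ ∃ x ∈ I.fiber p, x ∉ K.fiber p := Iff.rfl
  have hKbot : ∀ p ∈ A, K.fiber p = ⊥ := by
    rintro p ⟨x, hx, hxK⟩
    exact (Submodule.eq_bot_iff _).2 fun y hy => not_not.1 fun hy0 => hxK (hdim p _ y x hy hy0)
  have hAB : ∀ p ∈ A, p ∈ B := by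
    rintro p ⟨x, hx, hxK⟩
    have : b.coord p x ≠ 0 := fun h0 => hxK <| by
      rw [b.coord_injective p (h0.trans (map_zero _).symm)]
      exact zero_mem _
    obtain ⟨i, hi⟩ := Finsupp.ne_iff.1 this
    exact b.mem_of_coord_ne_zero hi
  refine ⟨A, hAB, ?_⟩
  by_cases hA : ∃ p, p ∈ A
  · obtain ⟨p, hp⟩ := hA
    -- Fibers have dimension at most one, so `K` vanishes on `A`. Every point lies below a point of
    -- `A` and the structure maps of `Q` are injective, so `K` vanishes everywhere.
    have hK : ∀ q, K.fiber q = ⊥ := by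
      intro q
      obtain ⟨s, hps, hqs⟩ := exists_common_upper p q
      refine (Submodule.eq_bot_iff _).2 fun y hy => ?_
      have hs := K.map_le (homOfLE hqs) (Submodule.mem_map_of_mem hy)
      rw [hKbot s (A.upper hps hp), Submodule.mem_bot] at hs
      exact b.map_injective (homOfLE hqs) (hs.trans (map_zero _).symm)
    refine ⟨(b.subquot I K (fun _ => A) (fun q x => ⟨fun hx i hi => ?_, fun h => ?_⟩)
      (fun _ => hAB) hK).ofIso θ⟩
    · refine hAmem.2 ⟨x, hx, fun hxK => hi ?_⟩
      rw [hK, Submodule.mem_bot] at hxK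
      rw [hxK, (b.coord q).map_zero, Finsupp.zero_apply]
    · by_cases hx0 : x = 0
      · exact hx0 ▸ zero_mem _
      · have : b.coord q x ≠ 0 := fun h0 => hx0 (b.coord_injective q (h0.trans (map_zero _).symm))
        obtain ⟨i, hi⟩ := Finsupp.ne_iff.1 this
        obtain ⟨z, hz, hzK⟩ := h i hi
        exact hdim q _ z x hz fun h0 => hzK (h0 ▸ zero_mem _)
  · have hR0 : ∀ p (x : R.obj p), x = 0 := by
      intro p x
      apply (θ.app p).toLinearEquiv.injective
      rw [map_zero]
      obtain ⟨y, hy⟩ := Submodule.mkQ_surjective _ ((θ.app p).toLinearEquiv x)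
      rw [← hy]
      refine (Submodule.Quotient.mk_eq_zero _).2 ?_
      by_contra hyK
      exact hA ⟨p, y, y.2, hyK⟩
    exact ⟨{ coord := fun p => 0
             coord_map := fun _ _ => rfl
             coord_injective := fun p x y _ => (hR0 p x).trans (hR0 p y).symm
             exists_coord_eq := fun p y hy => ⟨0, Finsupp.ext fun i => by
               by_contra h
               exact hA ⟨p, hy i fun h0 => h h0.symm⟩⟩
             mem_of_coord_ne_zero := fun h => absurd rfl h }⟩

/-! ### Prunings of upset-decomposable modules -/

/-- The relation `U i ⊆ U j (2ε)`. -/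
def PruneRel (ε : ℝ≥0) {ι : Type u} (U : ι → UpperSet (Pt d)) (i j : ι) : Prop :=
  ∀ p ∈ U i, shiftPt ((2 * ε : ℝ≥0) : ℝ) p ∈ U j

/-- The intersection of the upsets reachable from `U i` along `PruneRel`. -/
def pruneUpset (ε : ℝ≥0) {ι : Type u} (U : ι → UpperSet (Pt d)) (i : ι) : UpperSet (Pt d) where
  carrier := {p | ∀ j, Relation.ReflTransGen (PruneRel ε U) i j → p ∈ U j}
  upper' _ _ h hp j hj := (U j).upper h (hp j hj)

/-- The `i`-th upset of the `ε`-pruning of the sum of the upset modules of `U`. -/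
def prunedUpset (ε : ℝ≥0) {ι : Type u} (U : ι → UpperSet (Pt d)) (i : ι) : UpperSet (Pt d) :=
  shiftUpper (-(ε : ℝ)) (pruneUpset ε U i)

namespace UpsetCoords

variable {X : PersMod k d} {ι : Type u} {U : ι → UpperSet (Pt d)}

/-- An edge from `j` to `j'` makes the matrix unit a morphism to the `2ε`-shift, so a nonzero
coordinate in the upper submodule propagates along paths. Conversely, a nonzero matrix entry is an
edge, and `pruneUpset` grows along edges, so the submodule spanned by the allowed coordinates
satisfies the pruning condition. -/
theorem mem_pruningUpper_iff (a : UpsetCoords X U) (ε : ℝ≥0) (p : Pt d) (x : X.obj p) :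
    x ∈ (pruningUpper ε X).fiber p ↔ ∀ i, a.coord p x i ≠ 0 → p ∈ pruneUpset ε U i := by
  constructor
  · intro hx i hi j hij
    suffices h : ∃ x' ∈ (pruningUpper ε X).fiber p, a.coord p x' j ≠ 0 by
      obtain ⟨x', -, h⟩ := h
      exact a.mem_of_coord_ne_zero h
    induction hij with
    | refl => exact ⟨x, hx, hi⟩
    | @tail j j' _ hjj' ih =>
      classical
      obtain ⟨y, hy, hyj⟩ := ih
      obtain ⟨f, hf⟩ := a.exists_hom (a.shift ((2 * ε : ℝ≥0) : ℝ))
        (Finsupp.lsingle j' ∘ₗ Finsupp.lapply j) fun q z l hl => by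
          by_cases h : j' = l
          · subst h
            exact hjj' q (a.mem_of_coord_ne_zero (x := z) (i := j) (by simpa using hl))
          · simp [h] at hl
      obtain ⟨y', hy', h⟩ := (pruningUpper_isGreatest ε X).1 f p (Submodule.mem_map_of_mem hy)
      refine ⟨y', hy', ?_⟩
      have e1 : a.coord p y' = (a.shift ((2 * ε : ℝ≥0) : ℝ)).coord p ((f.app p).hom y) := by
        rw [← h]
        exact (a.coord_map _ y').symm
      rw [e1, hf]
      simpa using hyj
  · let I : Sub X :=
      { fiber := fun p => (Finsupp.supported k k {i | p ∈ pruneUpset ε U i}).comap (a.coord p)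
        map_le := fun {p q} h => by
          rintro _ ⟨x, hx, rfl⟩
          rw [Submodule.mem_comap, a.coord_map]
          exact Finsupp.supported_mono (fun i hi => (pruneUpset ε U i).upper (leOfHom h) hi) hx }
    have hI : ∀ p x, x ∈ I.fiber p ↔ ∀ i, a.coord p x i ≠ 0 → p ∈ pruneUpset ε U i :=
      fun p x => by
        change a.coord p x ∈ Finsupp.supported k k _ ↔ _
        rw [Finsupp.mem_supported, Set.subset_def]
        simp only [Finset.mem_coe, Finsupp.mem_support_iff, Set.mem_ofPred_eq]
    suffices h : IsPruningUpper ε I from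
      fun hx => (pruningUpper_isGreatest ε X).2 h p ((hI p x).2 hx)
    rintro f p _ ⟨x, hx, rfl⟩
    obtain ⟨F, hF, hFU⟩ := a.exists_matrix (a.shift ((2 * ε : ℝ≥0) : ℝ)) f
    obtain ⟨e, he, hz⟩ := (a.shift ((2 * ε : ℝ≥0) : ℝ)).exists_eq_sum ((f.app p).hom x)
    rw [hz]
    refine Submodule.sum_mem _ fun j hj => Submodule.smul_mem _ _ ?_
    rw [Finsupp.mem_support_iff] at hj
    have hej := he j hj
    rw [hF] at hj
    obtain ⟨i, hi, hij⟩ := exists_index_of_apply_ne_zero hj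
    have hrel : PruneRel ε U i j := hFU i j hij
    have hp : p ∈ pruneUpset ε U j := fun l hl => (hI p x).1 hx i hi l (.head hrel hl)
    obtain ⟨y, hy⟩ := a.exists_coord_eq_single (hp j .refl)
    refine ⟨y, (hI p y).2 fun l hl => ?_, (a.shift _).coord_injective p ?_⟩
    · rw [hy] at hl
      by_cases h : j = l
      · exact h ▸ hp
      · exact absurd (Finsupp.single_eq_of_ne (Ne.symm h)) hl
    · rw [hej, ← hy]
      exact a.coord_map _ y

/-- The zero submodule already meets the condition, since `M_{0 → 2ε}` is injective. -/
theorem pruningLower_fiber (a : UpsetCoords X U) (ε : ℝ≥0) (p : Pt d) :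
    (pruningLower ε X).fiber p = ⊥ := by
  suffices h : IsPruningLower ε (pruningUpper ε X) (botSub X) from
    le_bot_iff.1 ((pruningLower_isLeast ε X).2 h p)
  refine ⟨fun _ => bot_le, ?_⟩
  rintro f p x ⟨-, hx⟩
  rw [SetLike.mem_coe, Submodule.mem_comap] at hx
  have h0 : ((toShift (2 * ε) X).app p).hom x = 0 := by
    have hb : (botSub X).fiber p = ⊥ := rfl
    rwa [hb, Submodule.map_bot, Submodule.mem_bot] at hx
  exact a.map_injective (homOfLE (le_shiftPt (2 * ε).2 p)) (h0.trans (map_zero _).symm)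

/-- The coordinates of a pruning. -/
def pruning (a : UpsetCoords X U) (ε : ℝ≥0) : UpsetCoords (pruning ε X) (prunedUpset ε U) :=
  (a.subquot _ _ (pruneUpset ε U) (a.mem_pruningUpper_iff ε)
    (fun i _ hp => hp i .refl) (a.pruningLower_fiber ε)).shift _

end UpsetCoords

/-! ### Matchings and refinements in coordinates -/

theorem UpsetDecomposable.exists_upsetCoords {X : PersMod k d} (h : UpsetDecomposable X) :
    ∃ (ι : Type u) (U : ι → UpperSet (Pt d)), (∀ i, ∃ p, p ∈ U i) ∧
      Nonempty (UpsetCoords X U) := by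
  obtain ⟨ι, U, ⟨θ⟩⟩ := h
  refine ⟨{i // ∃ p, p ∈ U i}, fun i => U i, fun i => i.2,
    ⟨((UpsetCoords.dirSum U).ofIso θ).reindex Subtype.val Subtype.val_injective ?_⟩⟩
  intro i hi p hp
  exact hi ⟨⟨i, p, hp⟩, rfl⟩

/-- The members of a barcode of an upset-decomposable module are upset modules. -/
theorem IsBarcode.exists_upsetCoords {X : PersMod k d} {ι κ : Type u} {Q : κ → PersMod k d}
    {W : ι → UpperSet (Pt d)} (h : IsBarcode Q X) (a : UpsetCoords X W) :
    ∃ V : κ → UpperSet (Pt d), (∀ j, ∃ p, p ∈ V j) ∧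
      (∀ j, Nonempty (Q j ≅ upsetMod k (V j))) ∧ Nonempty (UpsetCoords X V) := by
  classical
  obtain ⟨hQ, ⟨θ⟩⟩ := h
  have hV : ∀ j, ∃ V : UpperSet (Pt d), Nonempty (Q j ≅ upsetMod k V) := fun j => by
    obtain ⟨i, ⟨e⟩⟩ := a.exists_iso_of_retract (hQ j) (dirSumIncl Q j ≫ θ.inv)
      (θ.hom ≫ dirSumProj Q j) (by simp [dirSumIncl_proj])
    exact ⟨W i, ⟨e.symm⟩⟩
  choose V hV using hV
  refine ⟨V, fun j => ?_, hV, ?_⟩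
  · obtain ⟨-, h⟩ := ((UpsetCoords.single (V j)).ofIso (hV j).some).exists_mem_of_not_isZero
      (hQ j).1
    exact h
  · obtain ⟨e⟩ := nonempty_dirSum_iso hV
    exact ⟨(UpsetCoords.dirSum V).ofIso (θ ≪≫ e)⟩

theorem UpsetCoords.isBarcode {X : PersMod k d} {ι : Type u} {U : ι → UpperSet (Pt d)}
    (a : UpsetCoords X U) (hU : ∀ i, ∃ p, p ∈ U i) :
    IsBarcode (fun i => upsetMod k (U i)) X :=
  ⟨fun i => indecomposable_upsetMod (hU i).choose_spec, a.nonempty_iso (dirSum U)⟩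

/-- Every summand is matched, because an unmatched one would be zero; the matching then serves as a
common index set for both modules. -/
theorem Matched.exists_upsetCoords {ε : ℝ≥0} {M N : PersMod k d} {ι₀ κ₀ : Type u}
    {U₀ : ι₀ → UpperSet (Pt d)} {V₀ : κ₀ → UpperSet (Pt d)} (a : UpsetCoords M U₀)
    (b : UpsetCoords N V₀) (h : Matched ε M N) :
    ∃ (ι : Type u) (U V : ι → UpperSet (Pt d)),
      Nonempty (UpsetCoords M U) ∧ Nonempty (UpsetCoords N V) ∧
      (∀ i, ∀ p ∈ U i, shiftPt ε p ∈ V i) ∧ ∀ i, ∀ p ∈ V i, shiftPt ε p ∈ U i := by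
  obtain ⟨ι, κ, Q, R, hQ, hR, S, T, σ, hσ, hS, hT⟩ := h
  obtain ⟨U, -, hQU, ha⟩ := hQ.exists_upsetCoords a
  obtain ⟨V, -, hRV, ⟨b'⟩⟩ := hR.exists_upsetCoords b
  have hS' : ∀ i, i ∈ S := fun i => by
    by_contra hi
    exact (hQ.1 i).1
      (((UpsetCoords.single (U i)).ofIso (hQU i).some).isZero_of_interleaved_zeroMod (hS i hi))
  have hT' : ∀ j, j ∈ T := fun j => by
    by_contra hj
    exact (hR.1 j).1
      (((UpsetCoords.single (V j)).ofIso (hRV j).some).isZero_of_interleaved_zeroMod (hT j hj))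
  let f : ι → κ := fun i => σ ⟨i, hS' i⟩
  have hf : f.Injective := fun i i' h => congrArg Subtype.val (σ.injective (Subtype.ext h))
  have hint : ∀ i, Interleaved ε (Q i) (R (f i)) := fun i => hσ ⟨i, hS' i⟩
  refine ⟨ι, U, fun i => V (f i), ha, ⟨b'.reindex f hf fun j hj => absurd ?_ hj⟩,
    fun i p hp => ?_, fun i p hp => ?_⟩
  · exact ⟨σ.symm ⟨j, hT' j⟩, congrArg Subtype.val (σ.apply_symm_apply ⟨j, hT' j⟩)⟩
  · exact ((UpsetCoords.single (U i)).ofIso (hQU i).some).shiftPt_mem_of_interleaved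
      ((UpsetCoords.single (V (f i))).ofIso (hRV (f i)).some) (hint i) hp
  · exact ((UpsetCoords.single (V (f i))).ofIso (hRV (f i)).some).shiftPt_mem_of_interleaved
      ((UpsetCoords.single (U i)).ofIso (hQU i).some) (hint i).symm hp

theorem UpsetCoords.matched {ε : ℝ≥0} {M N : PersMod k d} {ι κ : Type u}
    {U : ι → UpperSet (Pt d)} {V : κ → UpperSet (Pt d)} (a : UpsetCoords M U)
    (b : UpsetCoords N V) (hU : ∀ i, ∃ p, p ∈ U i) (hV : ∀ j, ∃ p, p ∈ V j) (e : ι ≃ κ)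
    (h : ∀ i, ∀ p ∈ U i, shiftPt ε p ∈ V (e i)) (h' : ∀ i, ∀ p ∈ V (e i), shiftPt ε p ∈ U i) :
    Matched ε M N := by
  refine ⟨ι, κ, _, _, a.isBarcode hU, b.isBarcode hV, Set.univ, Set.univ,
    (Equiv.Set.univ ι).trans (e.trans (Equiv.Set.univ κ).symm), fun i => ?_,
    fun i hi => absurd (Set.mem_univ i) hi, fun j hj => absurd (Set.mem_univ j) hj⟩
  exact (single (U i)).interleaved (single (V (e i))) (fun _ => h i) (fun _ => h' i)

theorem UpsetCoords.inftyRefinement {X Y : PersMod k d} {ι : Type u}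
    {A B : ι → UpperSet (Pt d)} (a : UpsetCoords X A) (b : UpsetCoords Y B)
    (h : ∀ i, ∀ p ∈ A i, p ∈ B i) : InftyRefinement X Y := by
  -- Barcode members must be nonzero, so indices with `B i` empty are dropped; `A i` is empty there
  -- too. Remaining indices may still have `A i` empty, which is a zero subquotient.
  let s := {i // ∃ p, p ∈ B i}
  have b' : UpsetCoords Y fun i : s => B i := b.reindex Subtype.val Subtype.val_injective
    fun i hi p hp => hi ⟨⟨i, p, hp⟩, rfl⟩
  have a' : UpsetCoords X fun i : s => A i := a.reindex Subtype.val Subtype.val_injective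
    fun i hi p hp => hi ⟨⟨i, p, h i p hp⟩, rfl⟩
  exact ⟨s, _, fun i => upsetMod k (A i), b'.isBarcode fun i => i.2,
    fun i => isSubquotient_upsetMod (h i), a'.nonempty_iso (dirSum _)⟩

/-- Each `R i` is a summand of `X`, so its structure maps are injective and it is the upset module
of a subset of `V i`. Uniqueness of barcodes, used once for `X` and once for `Y`, replaces the
decompositions hidden in the refinement by the given ones. -/
theorem InftyRefinement.exists_injective {X Y : PersMod k d} {ι κ : Type u}
    {A : ι → UpperSet (Pt d)} {B : κ → UpperSet (Pt d)} (h : InftyRefinement X Y)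
    (a : UpsetCoords X A) (b : UpsetCoords Y B) (hA : ∀ i, ∃ p, p ∈ A i) :
    ∃ f : ι → κ, f.Injective ∧ ∀ i, ∀ p ∈ A i, p ∈ B (f i) := by
  classical
  obtain ⟨l, Q, R, hQ, hRQ, ⟨θ⟩⟩ := h
  obtain ⟨V, hV, hQV, ⟨b'⟩⟩ := hQ.exists_upsetCoords b
  have hR : ∀ i, ∃ A' : UpperSet (Pt d), (∀ p ∈ A', p ∈ V i) ∧
      Nonempty (UpsetCoords (R i) fun _ : PUnit.{u + 1} => A') := fun i => by
    refine exists_upsetCoords_of_isSubquotient ((UpsetCoords.single (V i)).ofIso (hQV i).some)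
      (hRQ i) fun {p q} f x y hxy => ?_
    have hincl : ∀ z, ((dirSumProj R i).app p).hom (((dirSumIncl R i).app p).hom z) = z :=
      fun z => LinearMap.congr_fun (congrArg ModuleCat.Hom.hom
        (NatTrans.congr_app (dirSumIncl_proj R i) p)) z
    have hnat : ∀ z, ((dirSum R).map f).hom (((dirSumIncl R i).app p).hom z) =
        ((dirSumIncl R i).app q).hom (((R i).map f).hom z) := fun z =>
      (LinearMap.congr_fun (congrArg ModuleCat.Hom.hom ((dirSumIncl R i).naturality f)) z).symm
    rw [← hincl x, ← hincl y]
    congr 1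
    apply (a.ofIso θ.symm).map_injective f
    rw [hnat, hnat, hxy]
  choose A' hA' cR using hR
  have hRA : ∀ i, Nonempty (R i ≅ upsetMod k (A' i)) := fun i =>
    (cR i).some.nonempty_iso (UpsetCoords.single (A' i))
  obtain ⟨e⟩ := nonempty_dirSum_iso hRA
  obtain ⟨f, hf, hfA⟩ := a.exists_injective ((UpsetCoords.dirSum A').ofIso (θ ≪≫ e)) hA
  obtain ⟨g, hg, hgV⟩ := b'.exists_injective b hV
  refine ⟨g ∘ f, hg.comp hf, fun i p hp => ?_⟩
  rw [Function.comp_apply, hgV]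
  exact hA' (f i) p (hfA i ▸ hp)

/-! ### Matchings induce refinements of prunings -/

/-- Edges transfer by `U i ⊆ V i (ε) ⊆ V j (ε + 2δ) ⊆ U j (2ε + 2δ)`, so more indices are reachable
on the `U` side. The remaining `ε` between the two shifts pays for `U j ⊆ V j (ε)`. -/
theorem prunedUpset_subset {ι : Type u} {U V : ι → UpperSet (Pt d)} {ε : ℝ≥0}
    (h : ∀ i, ∀ p ∈ U i, shiftPt ε p ∈ V i) (h' : ∀ i, ∀ p ∈ V i, shiftPt ε p ∈ U i) (δ : ℝ≥0)
    (i : ι) (p : Pt d) (hp : p ∈ prunedUpset (ε + δ) U i) : p ∈ prunedUpset δ V i := by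
  have hrel : ∀ i j, PruneRel δ V i j → PruneRel (ε + δ) U i j := fun i j hij q hq => by
    have := h' j _ (hij _ (h i q hq))
    rw [shiftPt_shiftPt, shiftPt_shiftPt] at this
    convert this using 2
    push_cast
    ring
  intro j hj
  have := h j _ (hp j (Relation.ReflTransGen.mono hrel _ _ hj))
  rw [shiftPt_shiftPt] at this
  convert this using 2
  push_cast
  ring

theorem pruningDist_le_bottleneckDist {M N : PersMod k d} (hM : UpsetDecomposable M)
    (hN : UpsetDecomposable N) : pruningDist M N ≤ bottleneckDist M N := by
  obtain ⟨_, _, -, ⟨a₀⟩⟩ := hM.exists_upsetCoords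
  obtain ⟨_, _, -, ⟨b₀⟩⟩ := hN.exists_upsetCoords
  refine le_iInf₂ fun ε hε => iInf₂_le_of_le ε ?_ le_rfl
  obtain ⟨ι, U, V, ⟨a⟩, ⟨b⟩, h, h'⟩ := hε.exists_upsetCoords a₀ b₀
  exact fun δ => ⟨(a.pruning (ε + δ)).inftyRefinement (b.pruning δ) (prunedUpset_subset h h' δ),
    (b.pruning (ε + δ)).inftyRefinement (a.pruning δ) (prunedUpset_subset h' h δ)⟩

/-! ### From refinements to matchings -/

open Relation in
/-- If the `E`-successors of each member of a growing sequence of subsets of an `m`-element set lie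
in the next member, then everything reachable from the first member lies in member `m - 1`. -/
theorem reflTransGen_mem_of_growth {ι : Type*} [Fintype ι] (E : ι → ι → Prop) (I : ℕ → Finset ι)
    (hI : ∀ s, I s ⊆ I (s + 1)) (hE : ∀ s i j, i ∈ I s → E i j → j ∈ I (s + 1)) {i : ι}
    (hi : i ∈ I 0) {j : ι} (hij : ReflTransGen E i j) : j ∈ I (Fintype.card ι - 1) := by
  -- Either the set gains an element at each step, or it has become closed and already contains
  -- everything reachable. After `card - 1` steps the first case means it is the whole type.
  have claim : ∀ s, s + 1 ≤ (I s).card ∨ ∀ j, ReflTransGen E i j → j ∈ I s := by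
    intro s
    induction s with
    | zero => exact .inl (Finset.card_pos.2 ⟨i, hi⟩)
    | succ s ih =>
      rcases ih with h | h
      · by_cases hc : ∀ x ∈ I s, ∀ y, E x y → y ∈ I s
        · refine .inr fun j hj => hI s ?_
          induction hj with
          | refl => exact monotone_nat_of_le_succ hI (Nat.zero_le s) hi
          | tail _ hxy ih => exact hc _ ih _ hxy
        · push Not at hc
          obtain ⟨x, hx, y, hxy, hy⟩ := hc
          exact .inl (h.trans_lt (Finset.card_lt_card
            ⟨hI s, fun hs => hy (hs (hE s x y hx hxy))⟩))
      · exact .inr fun j hj => hI s (h j hj)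
  rcases claim (Fintype.card ι - 1) with h | h
  · have : I (Fintype.card ι - 1) = Finset.univ :=
      (Finset.card_eq_iff_eq_univ _).1 (le_antisymm (Finset.card_le_univ _) (by omega))
    rw [this]
    exact Finset.mem_univ j
  · exact h j hij

open Relation in
/-- The counting argument that closes up a cycle of two injections `τ` and `ρ` which carry closed
members of one growing sequence of subsets into the other. -/
theorem mem_of_alternating_growth {ι κ : Type*} [Fintype ι] [Fintype κ] [DecidableEq ι]
    [DecidableEq κ] (hcard : Fintype.card ι = Fintype.card κ) (E : ι → ι → Prop)
    (E' : κ → κ → Prop) (τ : ι → κ) (hτ : τ.Injective) (ρ : κ → ι) (hρ : ρ.Injective)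
    (I : ℕ → Finset ι) (K : ℕ → Finset κ)
    (hI : ∀ s, I s ⊆ I (s + 1)) (hK : ∀ s, K s ⊆ K (s + 1))
    (hE : ∀ s i j, i ∈ I s → E i j → j ∈ I (s + 1))
    (hE' : ∀ s i j, i ∈ K s → E' i j → j ∈ K (s + 1))
    (hIK : ∀ s i, (∀ j, ReflTransGen E i j → j ∈ I s) → τ i ∈ K (s + 1))
    (hKI : ∀ s i, (∀ j, ReflTransGen E' i j → j ∈ K s) → ρ i ∈ I s)
    {i : ι} (hi : τ i ∈ K 0) : i ∈ I (Fintype.card ι - 1) := by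
  have closedI : ∀ s, (∀ x ∈ I s, ∀ y, E x y → y ∈ I s) → (I s).image τ ⊆ K (s + 1) := by
    intro s hc y hy
    obtain ⟨x, hx, rfl⟩ := Finset.mem_image.1 hy
    refine hIK s x fun j hj => ?_
    induction hj with
    | refl => exact hx
    | tail _ hxy ih => exact hc _ ih _ hxy
  have closedK : ∀ s, (∀ x ∈ K s, ∀ y, E' x y → y ∈ K s) → (K s).image ρ ⊆ I s := by
    intro s hc y hy
    obtain ⟨x, hx, rfl⟩ := Finset.mem_image.1 hy
    refine hKI s x fun j hj => ?_
    induction hj with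
    | refl => exact hx
    | tail _ hxy ih => exact hc _ ih _ hxy
  -- If `I s` is closed, `τ` embeds it in `K (s + 1)`. Either `K (s + 1)` has an extra element, or
  -- it equals the image; it contains `τ i`, so then `i ∈ I s` by injectivity.
  have stepI : ∀ s, s + 1 ≤ (I s).card →
      s + 2 ≤ (K (s + 1)).card ∨ s + 2 ≤ (I (s + 1)).card ∨ i ∈ I (s + 1) := by
    intro s h
    by_cases hc : ∀ x ∈ I s, ∀ y, E x y → y ∈ I s
    · by_cases hs : s + 2 ≤ (K (s + 1)).card
      · exact .inl hs
      · have heq : (I s).image τ = K (s + 1) := Finset.eq_of_subset_of_card_le (closedI s hc)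
          (by rw [Finset.card_image_of_injective _ hτ]; omega)
        have := monotone_nat_of_le_succ hK (Nat.zero_le (s + 1)) hi
        rw [← heq] at this
        obtain ⟨x, hx, hxi⟩ := Finset.mem_image.1 this
        exact .inr (.inr (hI s (hτ hxi ▸ hx)))
    · push Not at hc
      obtain ⟨x, hx, y, hxy, hy⟩ := hc
      exact .inr (.inl (h.trans_lt (Finset.card_lt_card
        ⟨hI s, fun hs => hy (hs (hE s x y hx hxy))⟩)))
  have claim : ∀ s, s + 1 ≤ (K s).card ∨ s + 1 ≤ (I s).card ∨ i ∈ I s := by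
    intro s
    induction s with
    | zero => exact .inl (Finset.card_pos.2 ⟨_, hi⟩)
    | succ s ih =>
      rcases ih with h | h | h
      · by_cases hc : ∀ x ∈ K s, ∀ y, E' x y → y ∈ K s
        · refine stepI s (h.trans ?_)
          rw [← Finset.card_image_of_injective _ hρ]
          exact Finset.card_le_card (closedK s hc)
        · push Not at hc
          obtain ⟨x, hx, y, hxy, hy⟩ := hc
          exact .inl (h.trans_lt (Finset.card_lt_card
            ⟨hK s, fun hs => hy (hs (hE' s x y hx hxy))⟩))
      · exact stepI s h
      · exact .inr (.inr (hI s h))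
  have huniv : Fintype.card ι - 1 + 1 ≤ (I (Fintype.card ι - 1)).card →
      i ∈ I (Fintype.card ι - 1) := fun h => by
    have : I (Fintype.card ι - 1) = Finset.univ :=
      (Finset.card_eq_iff_eq_univ _).1 (le_antisymm (Finset.card_le_univ _) (by omega))
    rw [this]
    exact Finset.mem_univ i
  rcases claim (Fintype.card ι - 1) with h | h | h
  -- A full `K` is closed, so `ρ` carries it into `I` at the same stage, which is then full too.
  · have hKu : K (Fintype.card ι - 1) = Finset.univ :=
      (Finset.card_eq_iff_eq_univ _).1 (le_antisymm (Finset.card_le_univ _) (by omega))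
    refine huniv (h.trans ?_)
    rw [← Finset.card_image_of_injective _ hρ]
    exact Finset.card_le_card (closedK _ fun _ _ y _ => hKu ▸ Finset.mem_univ y)
  · exact huniv h
  · exact h

theorem shiftPt_le_shiftPt {a b : ℝ} (h : a ≤ b) (p : Pt d) : shiftPt a p ≤ shiftPt b p :=
  fun i => add_le_add_right h (p i)

theorem PruneRel.shiftPt_mem {ι : Type u} {U : ι → UpperSet (Pt d)} {ε : ℝ≥0} {i j : ι}
    (h : PruneRel ε U i j) {a b : ℝ} {p : Pt d} (hp : shiftPt a p ∈ U i) (hab : a + 2 * ε = b) :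
    shiftPt b p ∈ U j := by
  have := h _ hp
  rw [shiftPt_shiftPt] at this
  convert this using 2
  push_cast
  linarith

section Counting

variable {ι κ : Type u} [Fintype ι] {U : ι → UpperSet (Pt d)}
  {V : κ → UpperSet (Pt d)} {ε : ℝ≥0} {τ : ι → κ} {ρ : κ → ι}

/-- With the sets `{j | p + 2sε ∈ U j}`, `card ι - 1` steps put the shifted point into the pruned
upset of `i`; the last `ε` is the cost of `τ`. -/
theorem shiftPt_mem_of_prune_le (hτU : ∀ i, ∀ p ∈ pruneUpset ε U i, shiftPt ε p ∈ V (τ i))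
    {i : ι} {p : Pt d} (hp : p ∈ U i) :
    shiftPt ((2 * (Fintype.card ι - 1 : ℕ) + 1) * (ε : ℝ)) p ∈ V (τ i) := by
  classical
  have key : shiftPt (2 * (Fintype.card ι - 1 : ℕ) * (ε : ℝ)) p ∈ pruneUpset ε U i := by
    intro j hj
    have := reflTransGen_mem_of_growth (PruneRel ε U)
      (fun s => Finset.univ.filter fun i => shiftPt (2 * (s : ℝ) * ε) p ∈ U i)
      (fun s i hi => ?_) (fun s i j hi hij => ?_) (i := i) ?_ hj
    · simpa using this
    · simp only [Finset.mem_filter, Finset.mem_univ, true_and] at hi ⊢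
      refine (U i).upper (shiftPt_le_shiftPt ?_ p) hi
      have := ε.2
      gcongr
      simp
    · simp only [Finset.mem_filter, Finset.mem_univ, true_and] at hi ⊢
      exact hij.shiftPt_mem hi (by push_cast; ring)
    · simpa [shiftPt_zero] using hp
  have := hτU i _ key
  rw [shiftPt_shiftPt] at this
  convert this using 2
  ring

/-- Even multiples of `ε` are tested against `V`, odd ones against `U`. Thus `ρ` leads from stage
`s` of `V` to stage `s` of `U`, `τ` from there to stage `s + 1` of `V`, each at cost `ε`, and an
edge raises the stage by one. -/
theorem shiftPt_mem_of_prune_le_of_prune_le [Fintype κ] (hcard : Fintype.card ι = Fintype.card κ)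
    (hτ : τ.Injective) (hρ : ρ.Injective)
    (hτU : ∀ i, ∀ p ∈ pruneUpset ε U i, shiftPt ε p ∈ V (τ i))
    (hρV : ∀ j, ∀ p ∈ pruneUpset ε V j, shiftPt ε p ∈ U (ρ j)) {i : ι} {p : Pt d}
    (hp : p ∈ V (τ i)) : shiftPt ((2 * (Fintype.card ι - 1 : ℕ) + 1) * (ε : ℝ)) p ∈ U i := by
  classical
  have hε : (0 : ℝ) ≤ ε := ε.2
  have := mem_of_alternating_growth hcard (PruneRel ε U) (PruneRel ε V) τ hτ ρ hρ
    (fun s => Finset.univ.filter fun i => shiftPt ((2 * (s : ℝ) + 1) * ε) p ∈ U i)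
    (fun s => Finset.univ.filter fun j => shiftPt (2 * (s : ℝ) * ε) p ∈ V j)
    (fun s i hi => ?_) (fun s i hi => ?_) (fun s i j hi hij => ?_) (fun s i j hi hij => ?_)
    (fun s i hi => ?_) (fun s j hj => ?_) (i := i) ?_
  · simpa using this
  · simp only [Finset.mem_filter, Finset.mem_univ, true_and] at hi ⊢
    refine (U i).upper (shiftPt_le_shiftPt ?_ p) hi
    gcongr
    simp
  · simp only [Finset.mem_filter, Finset.mem_univ, true_and] at hi ⊢
    refine (V i).upper (shiftPt_le_shiftPt ?_ p) hi
    gcongr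
    simp
  · simp only [Finset.mem_filter, Finset.mem_univ, true_and] at hi ⊢
    exact hij.shiftPt_mem hi (by push_cast; ring)
  · simp only [Finset.mem_filter, Finset.mem_univ, true_and] at hi ⊢
    exact hij.shiftPt_mem hi (by push_cast; ring)
  · simp only [Finset.mem_filter, Finset.mem_univ, true_and] at hi ⊢
    have := hτU i _ hi
    rw [shiftPt_shiftPt] at this
    convert this using 2
    push_cast
    ring
  · simp only [Finset.mem_filter, Finset.mem_univ, true_and] at hj ⊢
    have := hρV j _ hj
    rw [shiftPt_shiftPt] at this
    convert this using 2
    ring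
  · simpa [shiftPt_zero] using hp

end Counting

/-! ### Bounded dimension and the Lipschitz bound -/

theorem exists_forall_mem_finset {ι : Type*} {U : ι → UpperSet (Pt d)}
    (hU : ∀ i, ∃ p, p ∈ U i) (s : Finset ι) : ∃ p, ∀ i ∈ s, p ∈ U i := by
  classical
  induction s using Finset.induction_on with
  | empty => exact ⟨fun _ => 0, by simp⟩
  | insert i s _ ih =>
    obtain ⟨p, hp⟩ := ih
    obtain ⟨q, hq⟩ := hU i
    obtain ⟨t, hpt, hqt⟩ := exists_common_upper p q
    refine ⟨t, fun j hj => ?_⟩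
    rcases Finset.mem_insert.1 hj with rfl | hj
    · exact (U j).upper hqt hq
    · exact (U j).upper hpt (hp j hj)

/-- At a common point of finitely many of the upsets, their generators are linearly independent. -/
theorem UpsetCoords.card_le_of_supdim_le {X : PersMod k d} {ι : Type u}
    {U : ι → UpperSet (Pt d)} (a : UpsetCoords X U) (hU : ∀ i, ∃ p, p ∈ U i) {r : ℕ}
    (hr : supdim X ≤ r) : Cardinal.mk ι ≤ r := by
  refine Cardinal.card_le_of fun s => ?_
  obtain ⟨p, hp⟩ := exists_forall_mem_finset hU s
  choose e he using fun i : s => a.exists_coord_eq_single (hp i i.2)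
  have hli : LinearIndependent k e := by
    refine LinearIndependent.of_comp (a.coord p) ?_
    have : a.coord p ∘ e = Finsupp.basisSingleOne ∘ Subtype.val :=
      funext fun i => by simp [he]
    rw [this]
    exact (Finsupp.basisSingleOne (R := k)).linearIndependent.comp _ Subtype.val_injective
  have h1 := Cardinal.toENat.monotone' hli.cardinal_le_rank
  have h2 := (le_iSup (fun p => Cardinal.toENat (Module.rank k (X.obj p))) p).trans hr
  simpa using h1.trans h2

theorem nonempty_pruneUpset {ι : Type u} [Fintype ι] {U : ι → UpperSet (Pt d)}
    (hU : ∀ i, ∃ p, p ∈ U i) (ε : ℝ≥0) (i : ι) : ∃ p, p ∈ pruneUpset ε U i :=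
  (exists_forall_mem_finset hU Finset.univ).imp fun _ hp j _ => hp j (Finset.mem_univ j)

/-- The inclusion of the `0`-pruned upset in `V j` comes from the empty path, so the `0`-pruning
need not be computed. Finiteness of `ι` keeps the pruned upsets of `U` nonempty, so `τ` is defined
on all of `ι`. -/
theorem InftyRefinement.exists_injective_of_pruning {M N : PersMod k d} {ι κ : Type u}
    [Fintype ι] {U : ι → UpperSet (Pt d)} {V : κ → UpperSet (Pt d)} {ε : ℝ≥0}
    (h : InftyRefinement (pruning (ε + 0) M) (pruning 0 N)) (a : UpsetCoords M U)
    (b : UpsetCoords N V) (hU : ∀ i, ∃ p, p ∈ U i) :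
    ∃ τ : ι → κ, τ.Injective ∧ ∀ i, ∀ p ∈ pruneUpset ε U i, shiftPt ε p ∈ V (τ i) := by
  rw [add_zero] at h
  have hmem : ∀ i, ∀ p ∈ pruneUpset ε U i, shiftPt ε p ∈ prunedUpset ε U i := fun i p hp => by
    rw [prunedUpset, mem_shiftUpper, shiftPt_shiftPt, neg_add_cancel, shiftPt_zero]
    exact hp
  obtain ⟨τ, hτ, h⟩ := h.exists_injective (a.pruning ε) (b.pruning 0) fun i =>
    (nonempty_pruneUpset hU ε i).imp' (shiftPt ε) (hmem i)
  refine ⟨τ, hτ, fun i p hp => ?_⟩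
  have := h i _ (hmem i p hp) _ .refl
  rwa [NNReal.coe_zero, neg_zero, shiftPt_zero] at this

theorem bottleneckDist_le_mul_pruningDist {M N : PersMod k d} (hM : UpsetDecomposable M)
    (hN : UpsetDecomposable N) {r : ℕ} (hr : 1 ≤ r) (hMr : supdim M ≤ r) (hNr : supdim N ≤ r) :
    bottleneckDist M N ≤ ((2 * r - 1 : ℕ) : ℝ≥0∞) * pruningDist M N := by
  obtain ⟨ι, U, hU, ⟨a⟩⟩ := hM.exists_upsetCoords
  obtain ⟨κ, V, hV, ⟨b⟩⟩ := hN.exists_upsetCoords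
  have hι := a.card_le_of_supdim_le hU hMr
  have hκ := b.card_le_of_supdim_le hV hNr
  have : Finite ι := Cardinal.lt_aleph0_iff_finite.1 (hι.trans_lt (Cardinal.natCast_lt_aleph0))
  have : Finite κ := Cardinal.lt_aleph0_iff_finite.1 (hκ.trans_lt (Cardinal.natCast_lt_aleph0))
  have := Fintype.ofFinite ι
  have := Fintype.ofFinite κ
  rw [Cardinal.mk_fintype, Nat.cast_le] at hι
  have hr0 : ((2 * r - 1 : ℕ) : ℝ≥0∞) ≠ 0 := Nat.cast_ne_zero.2 (by omega)
  rw [pruningDist]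
  simp only [ENNReal.mul_iInf_of_ne hr0 (ENNReal.natCast_ne_top _)]
  refine le_iInf₂ fun ε hε => ?_
  obtain ⟨τ, hτ, hτU⟩ := (hε 0).1.exists_injective_of_pruning a b hU
  obtain ⟨ρ, hρ, hρV⟩ := (hε 0).2.exists_injective_of_pruning b a hV
  have hcard : Fintype.card ι = Fintype.card κ :=
    le_antisymm (Fintype.card_le_of_injective τ hτ) (Fintype.card_le_of_injective ρ hρ)
  have hle : (2 * (Fintype.card ι - 1 : ℕ) + 1) * (ε : ℝ) ≤
      (((2 * r - 1 : ℕ) * ε : ℝ≥0) : ℝ) := by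
    -- For empty barcodes the truncated subtraction leaves `1` on the left, which `r ≥ 1` still
    -- covers.
    have h1 : 2 * (Fintype.card ι - 1) + 1 ≤ 2 * r - 1 := by omega
    have h2 : (2 * (Fintype.card ι - 1 : ℕ) + 1 : ℝ) ≤ (2 * r - 1 : ℕ) := by exact_mod_cast h1
    rw [NNReal.coe_mul, NNReal.coe_natCast]
    exact mul_le_mul_of_nonneg_right h2 ε.2
  have hm : Matched ((2 * r - 1 : ℕ) * ε) M N :=
    a.matched b hU hV
      (Equiv.ofBijective τ ((Fintype.bijective_iff_injective_and_card τ).2 ⟨hτ, hcard⟩))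
      (fun i p hp => (V (τ i)).upper (shiftPt_le_shiftPt hle p) (shiftPt_mem_of_prune_le hτU hp))
      (fun i p hp => (U i).upper (shiftPt_le_shiftPt hle p)
        (shiftPt_mem_of_prune_le_of_prune_le hcard hτ hρ hτU hρV hp))
  refine (iInf₂_le (f := fun (ε : ℝ≥0) (_ : Matched ε M N) => (ε : ℝ≥0∞)) _ hm).trans
    (le_of_eq ?_)
  push_cast
  rfl

end Persistence

end

theorem mainTheorem2 {k : Type u} [Field k] {d : ℕ} (M N : Persistence.PersMod k d)
    (hM : Persistence.PFD M) (hN : Persistence.PFD N)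
    (hMU : Persistence.UpsetDecomposable M) (hNU : Persistence.UpsetDecomposable N) :
    Persistence.pruningDist M N ≤ Persistence.bottleneckDist M N ∧
    ∀ r : ℕ, 1 ≤ r → Persistence.supdim M ≤ r → Persistence.supdim N ≤ r →
      Persistence.bottleneckDist M N ≤
        ((2 * r - 1 : ℕ) : ENNReal) * Persistence.pruningDist M N := by
  exact ⟨Persistence.pruningDist_le_bottleneckDist hMU hNU, fun _ hr hMr hNr =>
    Persistence.bottleneckDist_le_mul_pruningDist hMU hNU hr hMr hNr⟩
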